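/- Let $E=(E^0,E^1,r,s)$ be a finite directed graph (finitely many vertices and edges) without sinks ($s^{-1}(v)\neq\emptyset$ for every vertex $v$) and without sources ($r^{-1}(v)\neq\emptyset$ for every vertex $v$). A path of length $k\ge 1$ is a sequence $\mu=(\mu_1,\dots,\mu_k)$ of edges with $r(\mu_j)=s(\mu_{j+1})$ for $1\le j<k$, and a path of length $0$ is a vertex. A loop is a path of length at least $1$ with $s(\mu)=r(\mu)$. Assume that every loop $\mu$ in $E$ has an exit: some $s(\mu_j)$ emits at least two distinct edges. Let $C^*(E)$ be the universal $C^*$-algebra generated by mutually orthogonal projections $P_v$ ($v\in E^0$) and partial isometries $S_e$ ($e\in E^1$) such that $S_e^*S_e=P_{r(e)}$, $S_e^*S_f=0$ for $e\ne f$, $S_eS_e^*\le P_{s(e)}$, and $P_v=\sum_{s(e)=v}S_eS_e^*$ for every vertex $v$; it is unital with $1=\sum_{v}P_v$. For a path $\mu$ put $S_\mu=S_{\mu_1}\cdots S_{\mu_k}$, and $S_v=P_v$ for a vertex $v$. Let $\gamma$ be the gauge action of $U(1)$ on $C^*(E)$, that is $\gamma_z(S_e)=zS_e$ and $\gamma_z(P_v)=P_v$,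 and let $\mathcal F_E=\{x\in C^*(E):\gamma_z(x)=x\text{ for all }z\in U(1)\}$ be its fixed-point algebra. Assume that the relative commutant $\mathcal F_E'\cap C^*(E)$ is trivial, that is, equal to $\mathbb C1$. Let $\mathcal U_E$ be the group of those unitaries of $C^*(E)$ that commute with all $P_v$. For $u\in\mathcal U_E$ let $\lambda_u$ be the $*$-endomorphism of $C^*(E)$ with $\lambda_u(S_e)=uS_e$ and $\lambda_u(P_v)=P_v$. Let $\mathcal P_E$ be the set of the unitaries of $C^*(E)$ that, for some $k\ge 0$, are a finite sum of words $S_\alpha S_\beta^*$ with $\alpha,\beta$ paths of length $k$. Let $\mathfrak{GR}_E$ be the subgroup of $\operatorname{Aut}(C^*(E))$ generated by the automorphisms $S_e\mapsto S_{\sigma(e)}$, $P_v\mapsto P_{\sigma(v)}$ that are induced by the automorphisms $\sigma$ of the graph $E$, and by those $\lambda_u$ with $u\in\mathcal P_E\cap\mathcal U_E$ that are automorphisms of $C^*(E)$. Then every element of infinite order in $\mathfrak{GR}_E$ has infinite order in $\operatorname{Out}(C^*(E))$ as well, where $\operatorname{Out}(C^*(E))$ is the quotient of $\operatorname{Aut}(C^*(E))$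 by the subgroup of the inner automorphisms $x\mapsto wxw^*$, with $w$ a unitary of $C^*(E)$. -/

import Mathlib

/-- A directed graph `E = (E⁰, E¹, r, s)` with vertex set `V` and edge set `W`;
multiple edges and one-edge loops are allowed. -/
structure DirectedGraph (V : Type*) (W : Type*) where
  /-- the range map -/
  r : W → V
  /-- the source map -/
  s : W → V

namespace DirectedGraph

universe u v w

variable {V : Type u} {W : Type v}

/-- Every vertex emits an edge. -/
def NoSinks (E : DirectedGraph V W) : Prop := ∀ x : V, ∃ e : W, E.s e = x

/-- Every vertex receives an edge. -/
def NoSources (E : DirectedGraph V W) : Prop := ∀ x : V, ∃ e : W, E.r e = x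

/-- `E.IsWalk x l y` says that the list of edges `l` is a path from `x` to `y`. The empty list is
the path of length `0` at the vertex `x`. -/
def IsWalk (E : DirectedGraph V W) : V → List W → V → Prop
  | x, [], y => x = y
  | x, e :: l, y => E.s e = x ∧ E.IsWalk (E.r e) l y

/-- A path of length `k`; for `k = 0` it is a vertex. -/
structure Path (E : DirectedGraph V W) (k : ℕ) where
  /-- the source `s(μ)` -/
  source : V
  /-- the edges `μ₁, …, μ_k` -/
  edges : List W
  /-- the range `r(μ)` -/
  range : V
  length_edges : edges.length = k
  isWalk : E.IsWalk source edges range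

/-- Every loop (a path of length at least `1` whose source is its range) passes through the source
of one of its edges that emits at least two distinct edges. -/
def EveryLoopHasExit (E : DirectedGraph V W) : Prop :=
  ∀ (k : ℕ) (μ : E.Path k), 1 ≤ k → μ.source = μ.range →
    ∃ e ∈ μ.edges, ∃ f g : W, f ≠ g ∧ E.s f = E.s e ∧ E.s g = E.s e

/-- An automorphism of the graph `E`: a pair of bijections of the vertices and of the edges that
intertwine the range and the source maps. -/
structure Automorphism (E : DirectedGraph V W) where
  /-- the permutation of the vertices -/
  onV : Equiv.Perm V
  /-- the permutation of the edges -/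
  onW : Equiv.Perm W
  map_r : ∀ e, E.r (onW e) = onV (E.r e)
  map_s : ∀ e, E.s (onW e) = onV (E.s e)

section

variable [Fintype V] [Fintype W]

open Classical in
/-- The relations that define the C⋆-algebra of a finite graph, for families in a unital ⋆-ring:
`P x` are mutually orthogonal projections with sum `1`, and (GA1), (GA2), (GA3) hold. In (GA2) the
inequality `S e * star (S e) ≤ P (s e)` of projections is spelled out. -/
structure IsCKFamily (E : DirectedGraph V W) {B : Type*} [Ring B] [StarRing B]
    (P : V → B) (S : W → B) : Prop where
  proj : ∀ x, IsStarProjection (P x)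
  orth : ∀ x y, x ≠ y → P x * P y = 0
  star_mul_self : ∀ e, star (S e) * S e = P (E.r e)
  star_mul : ∀ e f, e ≠ f → star (S e) * S f = 0
  le : ∀ e, P (E.s e) * (S e * star (S e)) = S e * star (S e)
  sum_eq : ∀ x, (∃ e, E.s e = x) →
    P x = ∑ e ∈ Finset.univ.filter (fun e => E.s e = x), S e * star (S e)
  unit : (1 : B) = ∑ x, P x

end

/-! ### The free unital ⋆-algebra on self-adjoint `P x` and arbitrary `S e` -/

/-- The letters `P x`, `S e` and `(S e)⋆`. -/
inductive Letter (V : Type u) (W : Type v) : Type (max u v)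
  | vert : V → Letter V W
  | edge : W → Letter V W
  | edgeStar : W → Letter V W

/-- The adjoint of a letter. -/
def Letter.adj : Letter V W → Letter V W
  | .vert x => .vert x
  | .edge e => .edgeStar e
  | .edgeStar e => .edge e

/-- Noncommutative polynomials in the letters, as the monoid algebra of the monoid of words. -/
def FreeStarAlg (_E : DirectedGraph V W) : Type (max u v) :=
  MonoidAlgebra ℂ (FreeMonoid (Letter V W))

namespace FreeStarAlg

noncomputable section

variable (E : DirectedGraph V W)

instance : Ring (FreeStarAlg E) :=
  inferInstanceAs (Ring (MonoidAlgebra ℂ (FreeMonoid (Letter V W))))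

instance : Algebra ℂ (FreeStarAlg E) :=
  inferInstanceAs (Algebra ℂ (MonoidAlgebra ℂ (FreeMonoid (Letter V W))))

/-- A letter as an element of the free ⋆-algebra. -/
def letter (a : Letter V W) : FreeStarAlg E :=
  MonoidAlgebra.of ℂ (FreeMonoid (Letter V W)) (FreeMonoid.of a)

/-- The unital algebra homomorphism with prescribed values on the letters. -/
def liftAlg {B : Type*} [Ring B] [Algebra ℂ B] (f : Letter V W → B) : FreeStarAlg E →ₐ[ℂ] B :=
  MonoidAlgebra.lift ℂ B (FreeMonoid (Letter V W)) (FreeMonoid.lift f)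

theorem liftAlg_letter {B : Type*} [Ring B] [Algebra ℂ B] (f : Letter V W → B)
    (a : Letter V W) : liftAlg E f (letter E a) = f a := by
  unfold liftAlg letter
  erw [MonoidAlgebra.lift_of]
  simp

theorem induct {motive : FreeStarAlg E → Prop} (one : motive 1)
    (mul : ∀ a x, motive x → motive (letter E a * x))
    (add : ∀ x y, motive x → motive y → motive (x + y))
    (smul : ∀ (c : ℂ) x, motive x → motive (c • x)) (x : FreeStarAlg E) : motive x := by
  refine MonoidAlgebra.induction_on (R := ℂ) (M := FreeMonoid (Letter V W)) x ?_ add smul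
  intro m
  induction m using FreeMonoid.recOn with
  | one => rw [map_one]; exact one
  | of_mul a m h => rw [map_mul]; exact mul a _ h

/-- The adjoint as a ring homomorphism into the opposite ring. -/
def starHom : FreeStarAlg E →+* (FreeStarAlg E)ᵐᵒᵖ :=
  letI A := MonoidAlgebra ℂ (FreeMonoid (Letter V W))
  (MonoidAlgebra.liftNCRingHom (k := ℂ) (G := FreeMonoid (Letter V W)) (R := Aᵐᵒᵖ)
    ((algebraMap ℂ Aᵐᵒᵖ).comp (starRingEnd ℂ))
    (FreeMonoid.lift fun a => MulOpposite.op
      (MonoidAlgebra.of ℂ (FreeMonoid (Letter V W)) (FreeMonoid.of a.adj)))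
    (fun c _ => Algebra.commutes (A := Aᵐᵒᵖ) (starRingEnd ℂ c) _) : A →+* Aᵐᵒᵖ)

theorem starHom_letter (a : Letter V W) :
    starHom E (letter E a) = MulOpposite.op (letter E a.adj) := by
  refine (MonoidAlgebra.liftNCRingHom_single _ _ _ _ _).trans ?_
  have h := RingHom.map_one
    ((algebraMap ℂ (MonoidAlgebra ℂ (FreeMonoid (Letter V W)))ᵐᵒᵖ).comp (starRingEnd ℂ))
  have h' := FreeMonoid.lift_eval_of (fun a : Letter V W => MulOpposite.op
    (MonoidAlgebra.of ℂ (FreeMonoid (Letter V W)) (FreeMonoid.of a.adj))) a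
  exact (congrArg₂ (fun x y : (MonoidAlgebra ℂ (FreeMonoid (Letter V W)))ᵐᵒᵖ => x * y)
    h h').trans (one_mul _)

theorem starHom_algebraMap (c : ℂ) :
    starHom E (algebraMap ℂ _ c) = algebraMap ℂ _ (starRingEnd ℂ c) := by
  refine (MonoidAlgebra.liftNCRingHom_single _ _ _ _ _).trans ?_
  exact (congrArg₂ (· * ·) rfl (map_one _)).trans (mul_one _)

theorem starHom_smul (c : ℂ) (x : FreeStarAlg E) :
    starHom E (c • x) = starRingEnd ℂ c • starHom E x := by
  rw [Algebra.smul_def, map_mul, starHom_algebraMap, Algebra.smul_def]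

/-- The adjoint: the conjugate-linear involution that reverses products and sends
`P x` to `P x` and `S e` to `(S e)⋆`. -/
instance : StarRing (FreeStarAlg E) where
  star x := (starHom E x).unop
  star_involutive x := by
    induction x using induct with
    | one => simp
    | mul a x h =>
      simp only [map_mul, MulOpposite.unop_mul, h, starHom_letter, MulOpposite.unop_op]
      cases a <;> rfl
    | add x y hx hy => simp only [map_add, MulOpposite.unop_add, hx, hy]
    | smul c x h => simp [starHom_smul, h]
  star_mul x y := by simp
  star_add x y := by simp

theorem star_letter (a : Letter V W) : star (letter E a) = letter E a.adj := by
  change (starHom E _).unop = _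
  rw [starHom_letter]; rfl

instance : StarModule ℂ (FreeStarAlg E) where
  star_smul c x := by
    change (starHom E _).unop = _ • (starHom E _).unop
    rw [starHom_smul]; rfl

/-- The ⋆-homomorphism with prescribed values on the letters. -/
def lift {B : Type*} [Ring B] [StarRing B] [Algebra ℂ B] [StarModule ℂ B]
    (f : Letter V W → B) (hf : ∀ a, f a.adj = star (f a)) : FreeStarAlg E →⋆ₐ[ℂ] B where
  __ := liftAlg E f
  map_star' x := by
    change liftAlg E f (star x) = star (liftAlg E f x)
    induction x using induct with
    | one => simp
    | mul a x h => simp [h, star_letter, liftAlg_letter, hf]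
    | add x y hx hy => simp [hx, hy]
    | smul c x h => simp [h]

theorem lift_letter {B : Type*} [Ring B] [StarRing B] [Algebra ℂ B] [StarModule ℂ B]
    (f : Letter V W → B) (hf : ∀ a, f a.adj = star (f a)) (a : Letter V W) :
    lift E f hf (letter E a) = f a := liftAlg_letter E f a

/-! ### The universal C⋆-seminorm -/

variable [Fintype V] [Fintype W]

/-- The free `P x`. -/
def p (x : V) : FreeStarAlg E := letter E (.vert x)

/-- The free `S e`. -/
def t (e : W) : FreeStarAlg E := letter E (.edge e)

open Classical in
/-- The elements that the defining relations of the graph C⋆-algebra set to zero. -/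
inductive Relator : FreeStarAlg E → Prop
  | idem (x : V) : Relator (p E x * p E x - p E x)
  | orth (x y : V) : x ≠ y → Relator (p E x * p E y)
  | star_mul_self (e : W) : Relator (star (t E e) * t E e - p E (E.r e))
  | star_mul (e f : W) : e ≠ f → Relator (star (t E e) * t E f)
  | le (e : W) : Relator (p E (E.s e) * (t E e * star (t E e)) - t E e * star (t E e))
  | sum_eq (x : V) : (∃ e, E.s e = x) →
      Relator (p E x - ∑ e ∈ Finset.univ.filter (fun e => E.s e = x), t E e * star (t E e))
  | unit : Relator (1 - ∑ x, p E x)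

/-- The C⋆-seminorms on the free ⋆-algebra in which the defining relations hold. -/
structure IsCStarSeminorm (q : Seminorm ℂ (FreeStarAlg E)) : Prop where
  mul_le : ∀ x y, q (x * y) ≤ q x * q y
  star_mul_self : ∀ x, q (star x * x) = q x * q x
  relator : ∀ x, Relator E x → q x = 0

/-- The largest C⋆-seminorm in which the defining relations hold. -/
def univ : Seminorm ℂ (FreeStarAlg E) := sSup {q | IsCStarSeminorm E q}

variable {E}

theorem IsCStarSeminorm.map_star {q : Seminorm ℂ (FreeStarAlg E)} (hq : IsCStarSeminorm E q)
    (x : FreeStarAlg E) : q (star x) = q x := by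
  have key : ∀ y, q y ≤ q (star y) := by
    intro y
    rcases (apply_nonneg q y).eq_or_lt with h | h
    · rw [← h]; exact apply_nonneg q _
    · have h1 := hq.star_mul_self y
      have h2 := hq.mul_le (star y) y
      rw [h1] at h2
      exact le_of_mul_le_mul_right h2 h
  refine le_antisymm ?_ (key x)
  simpa using key (star x)

theorem IsCStarSeminorm.p_le {q : Seminorm ℂ (FreeStarAlg E)} (hq : IsCStarSeminorm E q)
    (x : V) : q (p E x) ≤ 1 := by
  have h1 := hq.star_mul_self (p E x)
  have h2 : star (p E x) = p E x := star_letter E _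
  have h3 : q (p E x * p E x) = q (p E x) := by
    have h4 := hq.relator _ (Relator.idem x)
    have h5 := abs_sub_map_le_sub q (p E x * p E x) (p E x)
    rw [h4] at h5
    linarith [abs_nonpos_iff.1 h5]
  rw [h2, h3] at h1
  by_contra h
  nlinarith

theorem IsCStarSeminorm.t_le {q : Seminorm ℂ (FreeStarAlg E)} (hq : IsCStarSeminorm E q)
    (e : W) : q (t E e) ≤ 1 := by
  have h1 := hq.star_mul_self (t E e)
  have h3 : q (star (t E e) * t E e) = q (p E (E.r e)) := by
    have h4 := hq.relator _ (Relator.star_mul_self e)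
    have h5 := abs_sub_map_le_sub q (star (t E e) * t E e) (p E (E.r e))
    rw [h4] at h5
    linarith [abs_nonpos_iff.1 h5]
  have h6 := hq.p_le (E.r e)
  rw [h3] at h1
  by_contra h
  nlinarith

theorem IsCStarSeminorm.letter_le {q : Seminorm ℂ (FreeStarAlg E)} (hq : IsCStarSeminorm E q)
    (a : Letter V W) : q (letter E a) ≤ 1 := by
  cases a with
  | vert x => exact hq.p_le x
  | edge e => exact hq.t_le e
  | edgeStar e =>
    have h : letter E (.edgeStar e) = star (t E e) := (star_letter E (.edge e)).symm
    rw [h, hq.map_star]; exact hq.t_le e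

theorem IsCStarSeminorm.one_le {q : Seminorm ℂ (FreeStarAlg E)} (hq : IsCStarSeminorm E q) :
    q 1 ≤ 1 := by
  have h := hq.star_mul_self 1
  rw [star_one, one_mul] at h
  by_contra h'
  nlinarith

variable (E)

theorem exists_bound (x : FreeStarAlg E) :
    ∃ C : ℝ, ∀ q : Seminorm ℂ (FreeStarAlg E), IsCStarSeminorm E q → q x ≤ C := by
  induction x using induct with
  | one => exact ⟨1, fun q hq => hq.one_le⟩
  | mul a x h =>
    obtain ⟨C, hC⟩ := h
    refine ⟨C, fun q hq => (hq.mul_le _ _).trans ?_⟩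
    have h1 := hq.letter_le a
    have h2 := apply_nonneg q x
    have h3 := hC q hq
    nlinarith
  | add x y hx hy =>
    obtain ⟨C, hC⟩ := hx
    obtain ⟨D, hD⟩ := hy
    exact ⟨C + D, fun q hq => (map_add_le_add q x y).trans (add_le_add (hC q hq) (hD q hq))⟩
  | smul c x h =>
    obtain ⟨C, hC⟩ := h
    refine ⟨‖c‖ * C, fun q hq => ?_⟩
    rw [map_smul_eq_mul]
    exact mul_le_mul_of_nonneg_left (hC q hq) (norm_nonneg c)

theorem bddAbove : BddAbove {q | IsCStarSeminorm E q} := by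
  rw [Seminorm.bddAbove_iff, bddAbove_pi]
  intro x
  obtain ⟨C, hC⟩ := exists_bound E x
  refine ⟨C, ?_⟩
  rintro _ ⟨_, ⟨q, hq, rfl⟩, rfl⟩
  exact hC q hq

theorem le_univ {q : Seminorm ℂ (FreeStarAlg E)} (hq : IsCStarSeminorm E q)
    (x : FreeStarAlg E) : q x ≤ univ E x := le_csSup (bddAbove E) hq x

theorem zero_isCStarSeminorm : IsCStarSeminorm E 0 :=
  ⟨fun _ _ => by simp, fun _ => by simp, fun _ _ => by simp⟩

theorem univ_le {x : FreeStarAlg E} {C : ℝ}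
    (h : ∀ q : Seminorm ℂ (FreeStarAlg E), IsCStarSeminorm E q → q x ≤ C) : univ E x ≤ C := by
  rw [univ, Seminorm.sSup_apply (bddAbove E)]
  have : Nonempty {q | IsCStarSeminorm E q} := ⟨⟨0, zero_isCStarSeminorm E⟩⟩
  exact ciSup_le fun q => h q.1 q.2

theorem univ_isCStarSeminorm : IsCStarSeminorm E (univ E) where
  mul_le x y := univ_le E fun q hq => (hq.mul_le x y).trans
    (mul_le_mul (le_univ E hq x) (le_univ E hq y) (apply_nonneg q y) (apply_nonneg _ x))
  star_mul_self x := by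
    apply le_antisymm
    · refine univ_le E fun q hq => ?_
      rw [hq.star_mul_self]
      exact mul_self_le_mul_self (apply_nonneg q x) (le_univ E hq x)
    · have h : univ E x ≤ Real.sqrt (univ E (star x * x)) := univ_le E fun q hq => by
        apply Real.le_sqrt_of_sq_le
        rw [sq, ← hq.star_mul_self]
        exact le_univ E hq _
      have h2 := mul_self_le_mul_self (apply_nonneg _ x) h
      rwa [Real.mul_self_sqrt (apply_nonneg _ _)] at h2
  relator x hx := le_antisymm (univ_le E fun q hq => (hq.relator x hx).le) (apply_nonneg _ x)

instance : SeminormedRing (FreeStarAlg E) where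
  toRing := inferInstance
  norm := univ E
  toPseudoMetricSpace :=
    (univ E).toAddGroupSeminorm.toSeminormedAddCommGroup.toPseudoMetricSpace
  dist_eq := (univ E).toAddGroupSeminorm.toSeminormedAddCommGroup.dist_eq
  norm_mul_le := (univ_isCStarSeminorm E).mul_le

theorem norm_def (x : FreeStarAlg E) : ‖x‖ = univ E x := rfl

instance : NormedSpace ℂ (FreeStarAlg E) where
  norm_smul_le c x := (map_smul_eq_mul (univ E) c x).le

theorem isometry_star : Isometry (star : FreeStarAlg E → FreeStarAlg E) :=
  AddMonoidHomClass.isometry_of_norm (starAddEquiv : FreeStarAlg E ≃+ FreeStarAlg E)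
    (univ_isCStarSeminorm E).map_star

end

end FreeStarAlg

noncomputable section

variable [Fintype V] [Fintype W]

/-! ### The graph C⋆-algebra and its universal property -/

/-- The C⋆-algebra `C⋆(E)` of a finite graph: the Hausdorff completion of the free ⋆-algebra in
the largest C⋆-seminorm in which the defining relations hold. -/
def CStar (E : DirectedGraph V W) : Type (max u v) := UniformSpace.Completion (FreeStarAlg E)

namespace CStar

open UniformSpace

variable (E : DirectedGraph V W)

instance : NormedRing (CStar E) := inferInstanceAs (NormedRing (Completion (FreeStarAlg E)))

instance : CompleteSpace (CStar E) := inferInstanceAs (CompleteSpace (Completion (FreeStarAlg E)))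

instance : NormedAlgebra ℂ (CStar E) where
  __ := (inferInstance : Algebra ℂ (Completion (FreeStarAlg E)))
  norm_smul_le c x := norm_smul_le (β := Completion (FreeStarAlg E)) c x

/-- The canonical map of the free ⋆-algebra into `C⋆(E)`. -/
def of (x : FreeStarAlg E) : CStar E := (x : Completion (FreeStarAlg E))

theorem of_add (x y : FreeStarAlg E) : of E (x + y) = of E x + of E y := Completion.coe_add x y
theorem of_mul (x y : FreeStarAlg E) : of E (x * y) = of E x * of E y := Completion.coe_mul x y
theorem of_one : of E 1 = 1 := Completion.coe_one _
theorem of_zero : of E 0 = 0 := Completion.coe_zero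
theorem of_sub (x y : FreeStarAlg E) : of E (x - y) = of E x - of E y := Completion.coe_sub x y
theorem of_smul (c : ℂ) (x : FreeStarAlg E) : of E (c • x) = c • of E x := Completion.coe_smul c x
theorem norm_of (x : FreeStarAlg E) : ‖of E x‖ = ‖x‖ := Completion.norm_coe x

theorem dense {C : CStar E → Prop} (hC : IsClosed {x | C x}) (h : ∀ x, C (of E x))
    (x : CStar E) : C x := Completion.induction_on x hC h

instance : Star (CStar E) where
  star := Completion.map (star : FreeStarAlg E → FreeStarAlg E)

theorem continuous_star' : Continuous (star : CStar E → CStar E) := Completion.continuous_map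

theorem of_star (x : FreeStarAlg E) : of E (star x) = star (of E x) :=
  (Completion.map_coe (FreeStarAlg.isometry_star E).uniformContinuous x).symm

instance : StarRing (CStar E) where
  star_involutive x := by
    have hc := continuous_star' E
    induction x using dense with
    | hC => exact isClosed_eq (hc.comp hc) continuous_id
    | h x => rw [← of_star, ← of_star, star_star]
  star_mul x y := by
    have hc := continuous_star' E
    induction x using dense with
    | hC => exact isClosed_eq (by fun_prop) (by fun_prop)
    | h x =>
      induction y using dense with
      | hC => exact isClosed_eq (by fun_prop) (by fun_prop)
      | h y => simp only [← of_star, ← of_mul, star_mul]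
  star_add x y := by
    have hc := continuous_star' E
    induction x using dense with
    | hC => exact isClosed_eq (by fun_prop) (by fun_prop)
    | h x =>
      induction y using dense with
      | hC => exact isClosed_eq (by fun_prop) (by fun_prop)
      | h y => simp only [← of_star, ← of_add, star_add]

instance : StarModule ℂ (CStar E) where
  star_smul c x := by
    have hc := continuous_star' E
    induction x using dense with
    | hC =>
      exact isClosed_eq (hc.comp (continuous_const_smul c)) (hc.const_smul (star c))
    | h x => simp only [← of_star, ← of_smul, star_smul]

instance : CStarRing (CStar E) where
  norm_mul_self_le x := by
    have hc := continuous_star' E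
    induction x using dense with
    | hC => exact isClosed_le (by fun_prop) (by fun_prop)
    | h x =>
      rw [← of_star, ← of_mul, norm_of, norm_of, FreeStarAlg.norm_def, FreeStarAlg.norm_def,
        (FreeStarAlg.univ_isCStarSeminorm E).star_mul_self]

instance : CStarAlgebra (CStar E) where

/-- The vertex projection `P_x`. -/
def P (x : V) : CStar E := of E (FreeStarAlg.p E x)

/-- The partial isometry `S_e`. -/
def S (e : W) : CStar E := of E (FreeStarAlg.t E e)

theorem of_relator {x : FreeStarAlg E} (h : FreeStarAlg.Relator E x) : of E x = 0 := by
  rw [← norm_eq_zero, norm_of, FreeStarAlg.norm_def,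
    (FreeStarAlg.univ_isCStarSeminorm E).relator x h]

/-- `of` as a ⋆-homomorphism. -/
def ofHom : FreeStarAlg E →⋆ₐ[ℂ] CStar E where
  toFun := of E
  map_one' := of_one E
  map_mul' := of_mul E
  map_zero' := of_zero E
  map_add' := of_add E
  commutes' _ := rfl
  map_star' := of_star E

/-- The generators of `C⋆(E)` satisfy the defining relations. -/
theorem isCKFamily : E.IsCKFamily (P E) (S E) where
  proj x := by
    have h : ofHom E _ = 0 := of_relator E (.idem x)
    rw [map_sub, map_mul, sub_eq_zero] at h
    exact ⟨h, (of_star E _).symm.trans (congrArg (of E) (FreeStarAlg.star_letter E (.vert x)))⟩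
  orth x y hxy := by
    have h : ofHom E _ = 0 := of_relator E (.orth x y hxy)
    rwa [map_mul] at h
  star_mul_self e := by
    have h : ofHom E _ = 0 := of_relator E (.star_mul_self e)
    rwa [map_sub, map_mul, map_star, sub_eq_zero] at h
  star_mul e f hef := by
    have h : ofHom E _ = 0 := of_relator E (.star_mul e f hef)
    rwa [map_mul, map_star] at h
  le e := by
    have h : ofHom E _ = 0 := of_relator E (.le e)
    rwa [map_sub, map_mul, map_mul, map_star, sub_eq_zero] at h
  sum_eq x hx := by
    have h : ofHom E _ = 0 := of_relator E (.sum_eq x hx)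
    simp only [map_sub, map_sum, map_mul, map_star, sub_eq_zero] at h
    exact h
  unit := by
    have h : ofHom E _ = 0 := of_relator E .unit
    simp only [map_sub, map_sum, map_one, sub_eq_zero] at h
    exact h

variable {E}

/-- The values on the letters that belong to a family `P`, `S`. -/
def letterVal {B : Type*} [Star B] (P : V → B) (S : W → B) : Letter V W → B
  | .vert x => P x
  | .edge e => S e
  | .edgeStar e => star (S e)

section Lift

variable {B : Type w} [CStarAlgebra B] {P' : V → B} {S' : W → B} (h : E.IsCKFamily P' S')

/-- The ⋆-homomorphism of the free ⋆-algebra given by a family. -/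
def preLift : FreeStarAlg E →⋆ₐ[ℂ] B :=
  FreeStarAlg.lift E (letterVal P' S') fun a => by
    cases a with
    | vert x => exact (h.proj x).isSelfAdjoint.symm
    | edge e => rfl
    | edgeStar e => exact (star_star _).symm

theorem preLift_p (x : V) : preLift h (FreeStarAlg.p E x) = P' x := FreeStarAlg.lift_letter E _ _ _

theorem preLift_t (e : W) : preLift h (FreeStarAlg.t E e) = S' e := FreeStarAlg.lift_letter E _ _ _

theorem norm_preLift_le (x : FreeStarAlg E) : ‖preLift h x‖ ≤ ‖x‖ := by
  let q : Seminorm ℂ (FreeStarAlg E) :=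
    (normSeminorm ℂ B).comp (preLift h).toAlgHom.toLinearMap
  have hq : ∀ y, q y = ‖preLift h y‖ := fun _ => rfl
  refine FreeStarAlg.le_univ E (q := q) ⟨fun x y => ?_, fun x => ?_, fun x hx => ?_⟩ x
  · rw [hq, hq, hq, map_mul]; exact norm_mul_le _ _
  · rw [hq, hq, map_mul, map_star]; exact CStarRing.norm_star_mul_self
  · rw [hq, norm_eq_zero]
    cases hx with
    | idem x => simpa [preLift_p, sub_eq_zero] using (h.proj x).isIdempotentElem.eq
    | orth x y hxy => simpa [preLift_p] using h.orth x y hxy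
    | star_mul_self e => simpa [map_star, preLift_p, preLift_t, sub_eq_zero] using h.star_mul_self e
    | star_mul e f hef => simpa [map_star, preLift_p, preLift_t, sub_eq_zero] using h.star_mul e f hef
    | le e => simpa [map_star, preLift_p, preLift_t, sub_eq_zero] using h.le e
    | sum_eq x hx => simpa [map_star, preLift_p, preLift_t, sub_eq_zero] using h.sum_eq x hx
    | unit => simpa [preLift_p, sub_eq_zero] using h.unit

theorem continuous_preLift : Continuous (preLift h) :=
  AddMonoidHomClass.continuous_of_bound (preLift h) 1 fun x => by
    simpa using norm_preLift_le h x

/-- The universal property: the ⋆-homomorphism of `C⋆(E)` given by a family in a C⋆-algebra. -/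
def lift : CStar E →⋆ₐ[ℂ] B where
  __ := (Completion.extensionHom (preLift h : FreeStarAlg E →+* B) (continuous_preLift h) :
      Completion (FreeStarAlg E) →+* B)
  commutes' c := by
    change Completion.extension (preLift h) (of E (algebraMap ℂ _ c)) = _
    refine (Completion.extensionHom_coe (preLift h : FreeStarAlg E →+* B)
      (continuous_preLift h) _).trans ?_
    exact AlgHomClass.commutes (preLift h) c
  map_star' x := by
    change Completion.extension (preLift h) (star x : CStar E) =
      star (Completion.extension (preLift h) (x : Completion (FreeStarAlg E)))
    have hc := continuous_star' E
    have he : Continuous (fun x : CStar E => Completion.extension (preLift h) x) :=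
      Completion.continuous_extension
    have ho : ∀ y, Completion.extension (preLift h) (of E y) = preLift h y :=
      Completion.extensionHom_coe (preLift h : FreeStarAlg E →+* B) (continuous_preLift h)
    induction x using dense with
    | hC => exact isClosed_eq (he.comp hc) (continuous_star.comp he)
    | h x => rw [← of_star, ho, ho, map_star]

theorem lift_of (x : FreeStarAlg E) : lift h (of E x) = preLift h x :=
  Completion.extensionHom_coe (preLift h : FreeStarAlg E →+* B) (continuous_preLift h) x

theorem lift_P (x : V) : lift h (P E x) = P' x := (lift_of h _).trans (preLift_p h x)

theorem lift_S (e : W) : lift h (S E e) = S' e := (lift_of h _).trans (preLift_t h e)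

end Lift

/-- A ⋆-homomorphism of `C⋆(E)` is determined by its values on the generators. -/
theorem hom_ext {B : Type w} [CStarAlgebra B] {f g : CStar E →⋆ₐ[ℂ] B}
    (hP : ∀ x, f (P E x) = g (P E x)) (hS : ∀ e, f (S E e) = g (S E e)) : f = g := by
  ext x
  have hf : Continuous f := AddMonoidHomClass.continuous_of_bound f 1 fun y => by
    simpa using NonUnitalStarAlgHom.norm_apply_le f y
  have hg : Continuous g := AddMonoidHomClass.continuous_of_bound g 1 fun y => by
    simpa using NonUnitalStarAlgHom.norm_apply_le g y
  induction x using dense with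
  | hC => exact isClosed_eq hf hg
  | h x =>
    induction x using FreeStarAlg.induct with
    | one => rw [of_one, map_one, map_one]
    | mul a x hx =>
      rw [of_mul, map_mul, map_mul, hx]
      congr 1
      cases a with
      | vert x => exact hP x
      | edge e => exact hS e
      | edgeStar e =>
        have ha : of E (FreeStarAlg.letter E (.edgeStar e)) = star (S E e) := by
          rw [S, ← of_star]; exact congrArg (of E) (FreeStarAlg.star_letter E (.edge e)).symm
        rw [ha, map_star, map_star, hS]
    | add x y hx hy => rw [of_add, map_add, map_add, hx, hy]
    | smul c x hx => rw [of_smul, map_smul, map_smul, hx]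

variable (E)

/-! ### The gauge action and its fixed-point algebra -/

theorem isCKFamily_gauge (z : Circle) :
    E.IsCKFamily (P E) (fun e => (z : ℂ) • S E e) := by
  have hz : (starRingEnd ℂ) (z : ℂ) * (z : ℂ) = 1 := by
    rw [← Complex.normSq_eq_conj_mul_self]; simp
  have h := isCKFamily E
  have hz' : (z : ℂ) * (starRingEnd ℂ) (z : ℂ) = 1 := by rw [mul_comm, hz]
  constructor
  · exact h.proj
  · exact h.orth
  · intro e
    simp [smul_smul, hz', h.star_mul_self]
  · intro e f hef
    simp [h.star_mul e f hef]
  · intro e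
    simp [smul_smul, hz, h.le]
  · intro x hx
    simpa [smul_smul, hz] using h.sum_eq x hx
  · exact h.unit

/-- The gauge action: `γ_z(S_e) = z S_e` and `γ_z(P_x) = P_x` for `z ∈ U(1)`. -/
def gauge (z : Circle) : CStar E →⋆ₐ[ℂ] CStar E := lift (isCKFamily_gauge E z)

/-- The core AF-subalgebra `F_E`: the fixed-point algebra of the gauge action. -/
def core : StarSubalgebra ℂ (CStar E) where
  carrier := {x | ∀ z, gauge E z x = x}
  mul_mem' hx hy z := by rw [map_mul, hx z, hy z]
  add_mem' hx hy z := by rw [map_add, hx z, hy z]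
  algebraMap_mem' c z := AlgHomClass.commutes _ c
  star_mem' hx z := by rw [map_star, hx z]

/-! ### The endomorphisms `λ_u` and the group `GR_E` -/

/-- The group `U_E` of the unitaries of `C⋆(E)` that commute with all vertex projections. -/
def unitaryU : Subgroup (unitary (CStar E)) where
  carrier := {u | ∀ x, Commute (u : CStar E) (P E x)}
  mul_mem' ha hb x := (ha x).mul_left (hb x)
  one_mem' x := Commute.one_left _
  inv_mem' {a} ha x := by
    have h := (ha x).star_star
    rwa [(isCKFamily E).proj x |>.isSelfAdjoint.star_eq] at h

theorem isCKFamily_lambda (u : unitaryU E) :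
    E.IsCKFamily (P E) (fun e => ((u : unitary (CStar E)) : CStar E) * S E e) := by
  obtain ⟨⟨a, ha⟩, hu⟩ := u
  have h1 : star a * a = 1 := Unitary.star_mul_self_of_mem ha
  have h2 : a * star a = 1 := Unitary.mul_star_self_of_mem ha
  have hc : ∀ x, a * P E x = P E x * a := fun x => hu x
  have h := isCKFamily E
  have key : ∀ e f, star (a * S E e) * (a * S E f) = star (S E e) * S E f := by
    intro e f
    rw [star_mul, mul_assoc, ← mul_assoc (star a), h1, one_mul]
  have key2 : ∀ e, (a * S E e) * star (a * S E e) = a * (S E e * star (S E e)) * star a := by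
    intro e
    rw [star_mul]; simp only [mul_assoc]
  constructor
  · exact h.proj
  · exact h.orth
  · intro e
    rw [key, h.star_mul_self]
  · intro e f hef
    rw [key, h.star_mul e f hef]
  · intro e
    rw [key2, ← mul_assoc, ← mul_assoc, ← hc, mul_assoc a, h.le]
  · intro x hx
    simp only [key2]
    rw [← Finset.sum_mul, ← Finset.mul_sum, ← h.sum_eq x hx, hc, mul_assoc, h2, mul_one]
  · exact h.unit

/-- The endomorphism `λ_u` of `C⋆(E)`: `λ_u(S_e) = u S_e` and `λ_u(P_x) = P_x`. -/
def lambda (u : unitaryU E) : CStar E →⋆ₐ[ℂ] CStar E := lift (isCKFamily_lambda E u)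

variable {E} in
/-- The partial isometry `S_μ = S_{μ₁} ⋯ S_{μ_k}` of a path. The factor `P_{s(μ)}` only matters for
`k = 0`, where `S_μ = P_{s(μ)}`, because `P_{s(e)} S_e = S_e`. -/
def pathS {k : ℕ} (μ : E.Path k) : CStar E := P E μ.source * (μ.edges.map (S E)).prod

/-- The set `P_E` of permutation unitaries: the unitaries that are a finite sum of words
`S_α S_β⋆` with `α` and `β` of the same length `k`, for some `k`. -/
def permUnitary : Set (unitary (CStar E)) :=
  {w | ∃ (k : ℕ) (Λ : Finset (E.Path k × E.Path k)),
    (w : CStar E) = ∑ q ∈ Λ, pathS q.1 * star (pathS q.2)}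

/-- The set `λ(P_E ∩ U_E)⁻¹` of the automorphisms of `C⋆(E)` of the form `λ_u` with a permutation
unitary `u ∈ U_E`. -/
def lambdaPerm : Set (CStar E ≃⋆ₐ[ℂ] CStar E) :=
  {α | ∃ u : unitaryU E, (u : unitary (CStar E)) ∈ permUnitary E ∧ ∀ x, α x = lambda E u x}

/-- The set `Γ_E` of the automorphisms of `C⋆(E)` that are induced by the automorphisms of `E`. -/
def graphAut : Set (CStar E ≃⋆ₐ[ℂ] CStar E) :=
  {α | ∃ σ : E.Automorphism,
    (∀ e, α (S E e) = S E (σ.onW e)) ∧ ∀ x, α (P E x) = P E (σ.onV x)}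

/-- The group `GR_E`, generated by `λ(P_E ∩ U_E)⁻¹` and `Γ_E`. -/
def groupGR : Subgroup (CStar E ≃⋆ₐ[ℂ] CStar E) := Subgroup.closure (lambdaPerm E ∪ graphAut E)

end CStar

end

end DirectedGraph

/-- The group of inner automorphisms `x ↦ u x u⋆`, with `u` unitary, of a unital C⋆-algebra. -/
noncomputable def innerAut (A : Type*) [CStarAlgebra A] : Subgroup (A ≃⋆ₐ[ℂ] A) :=
  (Unitary.conjStarAlgAut ℂ A).range

instance innerAut_normal (A : Type*) [CStarAlgebra A] : (innerAut A).Normal where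
  conj_mem := by
    rintro _ ⟨u, rfl⟩ g
    have h1 : star (g (u : A)) * g (u : A) = 1 := by
      rw [← map_star, ← map_mul, Unitary.star_mul_self_of_mem u.2, map_one]
    have h2 : g (u : A) * star (g (u : A)) = 1 := by
      rw [← map_star, ← map_mul, Unitary.mul_star_self_of_mem u.2, map_one]
    refine ⟨⟨g (u : A), h1, h2⟩, ?_⟩
    ext x
    simp [StarAlgEquiv.aut_inv, map_star]

/-- The outer automorphism group `Out(A) = Aut(A) / Inn(A)`. -/
abbrev OuterAut (A : Type*) [CStarAlgebra A] : Type _ := (A ≃⋆ₐ[ℂ] A) ⧸ innerAut A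

/-! It suffices that every inner automorphism in the group has finite order: if a power of g is
inner, that power has finite order, and so has g. An inner element of the group turns out to be
conjugation by a unitary that permutes paths of some fixed length, and such a unitary has finite
order.

The tool is integrality. An automorphism is integral if it sends each S_e and P_x to a sum, with
natural coefficients, of words S_a S_b⋆ of degree |a| − |b| equal to 1 and 0 respectively. All
elements of the group are integral (`groupGR_le`). Compressing a natural sum x of degree 0 by long
words, S_a⋆ x S_b, gives a natural multiple of a vertex projection, or zero. Hence such sums are
discrete in norm: two that are close are equal (`eq_of_norm_sub_lt`), and one close to c P_v is a
natural multiple of P_v (`exists_eq_nsmul_P`). This requires P_v ≠ 0, which is read off from a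
concrete representation.

Let h = Ad w be integral. It commutes with the gauge action, so w⋆γ_z(w) commutes with the core and
is a scalar by the assumption on the relative commutant. Averaging then approximates w by a
combination of words of a single degree d, and each x = S_a⋆ w S_b with a, b long and |a| − |b| = d
is close to a multiple of P_v, or to zero. Now x x⋆ = S_a⋆ h(S_b S_b⋆) S_a is a natural sum, so it
is 0 or P_v. The nonzero coefficients match the paths of one length with those of another
(`Implements.exists_matching`). Since the number of paths grows strictly with the length, which is
where exits and the absence of sources enter, d = 0 and the matching is a permutation π. Put p = ∑
S_{π(b)} S_b⋆.

Only phases remain. The unitary δ = p⋆w commutes with the range projections of long words, and b = δ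
S_e δ⋆ S_e⋆ is a diagonal natural sum with b b⋆ = S_e S_e⋆. A natural number whose square is 0 or 1
equals its square, so b = S_e S_e⋆ and δ S_e δ⋆ = S_e (`conj_S_eq_of_commute`). Thus Ad w = Ad p,
and p has finite order because π does. -/

section PullBack

/-! ### Partial isometries of ℓ² from partial bijections -/

open scoped ENNReal lp

variable {ι : Type*}

/-- The square-summable sequence `j ↦ x (f j)`, extended by zero where `f` is undefined. -/
noncomputable def PEquiv.pullLp (f : ι ≃. ι) (x : ℓ²(ι, ℂ)) : ℓ²(ι, ℂ) :=
  ⟨fun j => (f j).elim 0 x, by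
    have hx := (memℓp_gen_iff (by norm_num)).1 (lp.memℓp x)
    refine memℓp_gen ?_
    have h1 : Summable fun j : {j // (f j).isSome} =>
        ‖x ((f j.1).get j.2)‖ ^ (2 : ℝ≥0∞).toReal := by
      refine hx.comp_injective (i := fun j : {j // (f j).isSome} => (f j.1).get j.2) ?_
      intro a b hab
      apply Subtype.ext
      have ha : (f a.1).get a.2 ∈ f a.1 := Option.get_mem _
      have hb : (f b.1).get b.2 ∈ f b.1 := Option.get_mem _
      simp only at hab
      rw [← hab] at hb
      exact f.inj ha hb
    have h2 : Function.Injective (Subtype.val : {j // (f j).isSome} → ι) := Subtype.val_injective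
    refine (h2.summable_iff (f := fun j => ‖(f j).elim 0 x‖ ^ (2 : ℝ≥0∞).toReal) ?_).1 ?_
    · intro j hj
      have : f j = none := by
        by_contra h
        exact hj ⟨⟨j, Option.isSome_iff_ne_none.2 h⟩, rfl⟩
      simp [this]
    · refine h1.congr fun j => ?_
      obtain ⟨j, hj⟩ := j
      obtain ⟨i, hi⟩ := Option.isSome_iff_exists.1 hj
      simp [hi]⟩

theorem PEquiv.pullLp_apply (f : ι ≃. ι) (x : ℓ²(ι, ℂ)) (j : ι) :
    f.pullLp x j = (f j).elim 0 x := rfl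

/-- Both sides are sums over the graph of `f`, one indexed by the domain of `f` and the other by
that of `f.symm`; reindex along `f`. -/
theorem PEquiv.inner_pullLp (f : ι ≃. ι) (x y : ℓ²(ι, ℂ)) :
    inner ℂ (f.pullLp x) y = inner ℂ x (f.symm.pullLp y) := by
  rw [lp.inner_eq_tsum, lp.inner_eq_tsum]
  simp only [PEquiv.pullLp_apply]
  have key : ∀ (g : ι ≃. ι) (u : ι → ι → ℂ),
      (∑' j, (g j).elim 0 (fun i => u i j)) =
        ∑' j : {j // (g j).isSome}, u ((g j.1).get j.2) j.1 := by
    intro g u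
    rw [← tsum_subtype_eq_of_support_subset (s := {j | (g j).isSome})]
    · refine tsum_congr fun j => ?_
      obtain ⟨j, hj⟩ := j
      obtain ⟨i, hi⟩ := Option.isSome_iff_exists.1 hj
      simp [hi]
    · intro j hj
      by_contra h
      have : g j = none := by simpa using h
      simp [this] at hj
  have e1 := key f (fun i j => inner ℂ (x i) (y j))
  have e2 := key f.symm (fun j i => inner ℂ (x i) (y j))
  have e1' : (∑' j, inner ℂ ((f j).elim 0 x) (y j)) =
      ∑' j, (f j).elim 0 (fun i => inner ℂ (x i) (y j)) :=
    tsum_congr fun j => by cases f j <;> simp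
  have e2' : (∑' i, inner ℂ (x i) ((f.symm i).elim 0 y)) =
      ∑' i, (f.symm i).elim 0 (fun j => inner ℂ (x i) (y j)) :=
    tsum_congr fun j => by cases f.symm j <;> simp
  refine e1'.trans (e1.trans (Eq.trans ?_ (e2'.trans e2).symm))
  let φ : {j // (f j).isSome} ≃ {i // (f.symm i).isSome} :=
    { toFun := fun j => ⟨(f j.1).get j.2, Option.isSome_iff_exists.2
        ⟨j.1, f.eq_some_iff.2 (Option.get_mem _)⟩⟩
      invFun := fun i => ⟨(f.symm i.1).get i.2, Option.isSome_iff_exists.2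
        ⟨i.1, f.eq_some_iff.1 (Option.get_mem _)⟩⟩
      left_inv := fun j => Subtype.ext <| Option.get_of_mem _ <|
        f.eq_some_iff.2 (Option.get_mem _)
      right_inv := fun i => Subtype.ext <| Option.get_of_mem _ <|
        f.eq_some_iff.1 (Option.get_mem _) }
  rw [← φ.tsum_eq]
  refine tsum_congr fun j => ?_
  have : (f.symm (φ j).1).get (φ j).2 = j := congrArg Subtype.val (φ.left_inv j)
  simp only [this]
  rfl

theorem PEquiv.pullLp_symm_pullLp (f : ι ≃. ι) (x : ℓ²(ι, ℂ)) :
    f.pullLp (f.symm.pullLp (f.pullLp x)) = f.pullLp x := by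
  ext j
  simp only [PEquiv.pullLp_apply]
  cases h : f j with
  | none => rfl
  | some i =>
    have h' : f.symm i = some j := f.eq_some_iff.2 h
    simp [PEquiv.pullLp_apply, h, h']

/-- The bound follows from the formal adjoint alone. With T' the pull-back along `f.symm` and T T' T
= T, one has ‖T'Tx‖² = Re ⟨T'Tx, x⟩, so ‖T'Tx‖ ≤ ‖x‖, and then ‖Tx‖² = Re ⟨x, T'Tx⟩ ≤ ‖x‖². -/
theorem PEquiv.norm_pullLp_le (f : ι ≃. ι) (x : ℓ²(ι, ℂ)) : ‖f.pullLp x‖ ≤ ‖x‖ := by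
  have h1 : ‖f.symm.pullLp (f.pullLp x)‖ ≤ ‖x‖ := by
    have h : ‖f.symm.pullLp (f.pullLp x)‖ * ‖f.symm.pullLp (f.pullLp x)‖ ≤
        ‖f.symm.pullLp (f.pullLp x)‖ * ‖x‖ := by
      rw [← inner_self_eq_norm_mul_norm (𝕜 := ℂ), PEquiv.inner_pullLp, PEquiv.symm_symm,
        f.pullLp_symm_pullLp, ← f.symm_symm, ← PEquiv.inner_pullLp, f.symm_symm]
      exact re_inner_le_norm _ _
    rcases (norm_nonneg (f.symm.pullLp (f.pullLp x))).eq_or_lt with h0 | h0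
    · rw [← h0]; exact norm_nonneg x
    · exact le_of_mul_le_mul_left h h0
  have h2 : ‖f.pullLp x‖ * ‖f.pullLp x‖ ≤ ‖x‖ * ‖x‖ := by
    rw [← inner_self_eq_norm_mul_norm (𝕜 := ℂ), PEquiv.inner_pullLp]
    exact (re_inner_le_norm _ _).trans (mul_le_mul_of_nonneg_left h1 (norm_nonneg x))
  exact abs_le_of_sq_le_sq' (by nlinarith) (norm_nonneg x) |>.2

/-- The operator on `ℓ²` that pulls back along a partial bijection of the index set. -/
noncomputable def PEquiv.pullOp (f : ι ≃. ι) : ℓ²(ι, ℂ) →L[ℂ] ℓ²(ι, ℂ) :=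
  LinearMap.mkContinuous
    { toFun := f.pullLp
      map_add' := fun x y => by
        ext j
        change (f j).elim 0 (x + y : ℓ²(ι, ℂ)) = (f j).elim 0 x + (f j).elim 0 y
        cases f j with
        | none => exact (add_zero 0).symm
        | some i => rfl
      map_smul' := fun c x => by
        ext j
        change (f j).elim 0 (c • x : ℓ²(ι, ℂ)) = c * (f j).elim 0 x
        cases f j with
        | none => exact (mul_zero c).symm
        | some i => rfl } 1 fun x => by simpa using f.norm_pullLp_le x

theorem PEquiv.pullOp_apply (f : ι ≃. ι) (x : ℓ²(ι, ℂ)) (j : ι) :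
    f.pullOp x j = (f j).elim 0 x := rfl

theorem PEquiv.star_pullOp (f : ι ≃. ι) : star f.pullOp = f.symm.pullOp := by
  rw [ContinuousLinearMap.star_eq_adjoint]
  refine ((ContinuousLinearMap.eq_adjoint_iff _ _).2 fun x y => ?_).symm
  exact (f.symm.inner_pullLp x y).trans (by rw [f.symm_symm]; rfl)

end PullBack

/-! ### A representation in which no vertex projection vanishes -/

namespace DirectedGraph

open scoped lp

universe u v

variable {V : Type u} {W : Type v}

/-- Without sinks, the edges with source `x` cut countably many copies of `x` into countably many
pieces each. -/
theorem exists_equiv_prod_nat [Finite W] (E : DirectedGraph V W) (hs : E.NoSinks) :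
    ∃ f : W × ℕ ≃ V × ℕ, ∀ j, (f j).1 = E.s j.1 := by
  have h : ∀ x, Nonempty ({e // E.s e = x} × ℕ ≃ ℕ) := fun x => by
    obtain ⟨e, he⟩ := hs x
    have : Nonempty {e // E.s e = x} := ⟨⟨e, he⟩⟩
    have : Countable {e // E.s e = x} := Finite.to_countable
    exact nonempty_equiv_of_countable
  let g := fun x => Classical.choice (h x)
  refine ⟨⟨fun j => (E.s j.1, g (E.s j.1) (⟨j.1, rfl⟩, j.2)),
    fun j => (((g j.1).symm j.2).1.1, ((g j.1).symm j.2).2), fun j => ?_, fun j => ?_⟩,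
    fun j => rfl⟩
  · simp
  -- Stated for an arbitrary edge with source x, so that x can be replaced by that source and the
  -- dependence of `g` on it causes no transport.
  · have key : ∀ (x : V) (q : {e // E.s e = x}) (m : ℕ),
        (E.s q.1, g (E.s q.1) (⟨q.1, rfl⟩, m)) = (x, g x (q, m)) := by
      rintro _ ⟨e, rfl⟩ m
      rfl
    exact (key _ _ _).trans (by simp)

section Representation

variable (E : DirectedGraph V W) (f : W × ℕ ≃ V × ℕ)

open Classical in
/-- The partial bijection that underlies the operator of a vertex. -/
noncomputable def vertPEquiv (x : V) : V × ℕ ≃. V × ℕ := PEquiv.ofSet {j | j.1 = x}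

open Classical in
/-- The partial bijection that underlies the operator of an edge. -/
noncomputable def edgePEquiv (e : W) : V × ℕ ≃. V × ℕ where
  -- Pull-back is contravariant: the bijection goes from the piece of the copy of s(e) cut out by e
  -- to the copy of r(e), so that S_e carries the copy of ℓ²(ℕ) at r(e) onto that piece.
  toFun j := if (f.symm j).1 = e then some (E.r e, (f.symm j).2) else none
  invFun j := if j.1 = E.r e then some (f (e, j.2)) else none
  inv i j := by
    obtain ⟨⟨d, n⟩, rfl⟩ := f.surjective i
    obtain ⟨y, m⟩ := j
    simp only [Equiv.symm_apply_apply, Option.ite_none_right_eq_some,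
      Option.some.injEq, EmbeddingLike.apply_eq_iff_eq, Prod.mk.injEq]
    constructor
    · rintro ⟨rfl, rfl, rfl⟩; exact ⟨rfl, rfl, rfl⟩
    · rintro ⟨rfl, rfl, rfl⟩; exact ⟨rfl, rfl, rfl⟩

theorem pullOp_vertPEquiv_apply (x : V) (u : ℓ²(V × ℕ, ℂ)) (j : V × ℕ) [Decidable (j.1 = x)] :
    (vertPEquiv x).pullOp u j = if j.1 = x then u j else 0 := by
  rw [PEquiv.pullOp_apply]
  split_ifs with h
  · have : vertPEquiv x j = some j := if_pos h
    rw [this]; rfl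
  · have : vertPEquiv x j = none := if_neg h
    rw [this]; rfl

theorem pullOp_edgePEquiv_apply (e d : W) (n : ℕ) (u : ℓ²(V × ℕ, ℂ)) [Decidable (d = e)] :
    (edgePEquiv E f e).pullOp u (f (d, n)) = if d = e then u (E.r e, n) else 0 := by
  rw [PEquiv.pullOp_apply]
  split_ifs with h
  · have : edgePEquiv E f e (f (d, n)) = some (E.r e, (f.symm (f (d, n))).2) :=
      if_pos (by simpa using h)
    rw [this, f.symm_apply_apply]; rfl
  · have : edgePEquiv E f e (f (d, n)) = none := if_neg (by simpa using h)
    rw [this]; rfl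

theorem pullOp_edgePEquiv_symm_apply (e : W) (u : ℓ²(V × ℕ, ℂ)) (j : V × ℕ)
    [Decidable (j.1 = E.r e)] :
    (edgePEquiv E f e).symm.pullOp u j = if j.1 = E.r e then u (f (e, j.2)) else 0 := by
  rw [PEquiv.pullOp_apply]
  split_ifs with h
  · have : (edgePEquiv E f e).symm j = some (f (e, j.2)) := if_pos h
    rw [this]; rfl
  · have : (edgePEquiv E f e).symm j = none := if_neg h
    rw [this]; rfl

theorem isCKFamily_pullOp [Fintype V] [Fintype W] (hf : ∀ j, (f j).1 = E.s j.1) :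
    E.IsCKFamily (fun x => (vertPEquiv x).pullOp) (fun e => (edgePEquiv E f e).pullOp) := by
  classical
  -- S_e S_e⋆ is the projection onto the piece f({e} × ℕ). These pieces partition V × ℕ compatibly
  -- with sources, whence (GA2) and (GA3).
  have hrange : ∀ e d n u, ((edgePEquiv E f e).pullOp * star (edgePEquiv E f e).pullOp) u
      (f (d, n)) = if d = e then u (f (d, n)) else 0 := by
    intro e d n u
    rw [PEquiv.star_pullOp, mul_apply_eq_comp, pullOp_edgePEquiv_apply]
    split_ifs with h
    · rw [pullOp_edgePEquiv_symm_apply, if_pos rfl, h]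
    · rfl
  constructor
  · intro x
    refine ⟨?_, ?_⟩
    · ext u j
      simp only [mul_apply_eq_comp, pullOp_vertPEquiv_apply]
      split_ifs <;> rfl
    · rw [IsSelfAdjoint, PEquiv.star_pullOp, vertPEquiv, PEquiv.ofSet_symm]
  · intro x y hxy
    ext u j
    simp only [mul_apply_eq_comp, pullOp_vertPEquiv_apply]
    split_ifs with h1 h2
    · exact absurd (h1.symm.trans h2) hxy
    · rfl
    · rfl
  · intro e
    ext u j
    rw [PEquiv.star_pullOp, mul_apply_eq_comp, pullOp_edgePEquiv_symm_apply,
      pullOp_vertPEquiv_apply, pullOp_edgePEquiv_apply, if_pos rfl]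
    split_ifs with h
    · rw [← h]
    · rfl
  · intro e d hed
    ext u j
    rw [PEquiv.star_pullOp, mul_apply_eq_comp, pullOp_edgePEquiv_symm_apply,
      pullOp_edgePEquiv_apply, if_neg hed, ite_self]
    rfl
  · intro e
    ext u j
    obtain ⟨⟨d, n⟩, rfl⟩ := f.surjective j
    rw [mul_apply_eq_comp, pullOp_vertPEquiv_apply, hrange, hf]
    split_ifs with h1 h2 h2
    · rfl
    · rfl
    · exact absurd (congrArg E.s h2) h1
    · rfl
  · intro x _
    ext u j
    obtain ⟨⟨d, n⟩, rfl⟩ := f.surjective j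
    rw [pullOp_vertPEquiv_apply, hf, sum_apply, lp.coeFn_sum,
      Finset.sum_apply]
    simp only [hrange]
    rw [Finset.sum_ite_eq]
    congr 1
    simp
  · ext u j
    rw [sum_apply, lp.coeFn_sum, Finset.sum_apply]
    simp only [pullOp_vertPEquiv_apply]
    simp

end Representation

/-- The vertex projections of the C⋆-algebra of a finite graph without sinks do not vanish. -/
theorem CStar.P_ne_zero [Fintype V] [Fintype W] {E : DirectedGraph V W} (hs : E.NoSinks)
    (x : V) : CStar.P E x ≠ 0 := by
  classical
  obtain ⟨f, hf⟩ := E.exists_equiv_prod_nat hs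
  intro h
  have h1 := CStar.lift_P (E.isCKFamily_pullOp f hf) x
  rw [h, map_zero] at h1
  have h2 : (vertPEquiv x).pullOp (lp.single 2 (x, 0) (1 : ℂ)) (x, 0) = 1 := by
    rw [pullOp_vertPEquiv_apply, if_pos rfl, lp.single_apply_self]
  rw [← h1] at h2
  simp at h2

end DirectedGraph

/-! ### Projections and initial projections in a C⋆-algebra -/

theorem IsStarProjection.one_le_norm {A : Type*} [CStarAlgebra A] {p : A}
    (hp : IsStarProjection p) (h0 : p ≠ 0) : 1 ≤ ‖p‖ := by
  have h1 : ‖p‖ * ‖p‖ = ‖p‖ := by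
    rw [← CStarRing.norm_star_mul_self, hp.isSelfAdjoint.star_eq, hp.isIdempotentElem.eq]
  have h2 := norm_pos_iff.2 h0
  nlinarith

/-- (sp − s)⋆(sp − s) = p − p − p + p = 0. -/
theorem mul_eq_self_of_star_mul_self {A : Type*} [CStarAlgebra A] {s p : A}
    (hp : IsStarProjection p) (h : star s * s = p) : s * p = s := by
  have h1 : star (s * p - s) * (s * p - s) = 0 := by
    rw [star_sub, star_mul, hp.isSelfAdjoint.star_eq, sub_mul, mul_sub, mul_sub]
    have h2 := hp.isIdempotentElem.eq
    rw [show p * star s * (s * p) = p * (star s * s) * p by noncomm_ring,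
      show p * star s * s = p * (star s * s) by noncomm_ring,
      show star s * (s * p) = star s * s * p by noncomm_ring, h, h2, h2, sub_self]
  exact sub_eq_zero.1 (CStarRing.star_mul_self_eq_zero_iff _ |>.1 h1)

/-! ### Words in the generators -/

namespace DirectedGraph

universe u v

variable {V : Type u} {W : Type v}

/-- The lists of length `k`. -/
noncomputable def listsOfLength (W : Type v) [Finite W] (k : ℕ) : Finset (List W) :=
  (List.finite_length_eq W k).toFinset

@[simp]
theorem mem_listsOfLength [Finite W] {k : ℕ} {l : List W} :
    l ∈ listsOfLength W k ↔ l.length = k := by simp [listsOfLength]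

theorem sum_listsOfLength_zero [Finite W] {M : Type*} [AddCommMonoid M] (f : List W → M) :
    ∑ l ∈ listsOfLength W 0, f l = f [] := by
  have : listsOfLength W 0 = {[]} := by ext l; simp
  rw [this, Finset.sum_singleton]

theorem sum_listsOfLength_succ [Fintype W] {M : Type*} [AddCommMonoid M] (k : ℕ)
    (f : List W → M) :
    ∑ l ∈ listsOfLength W (k + 1), f l = ∑ e, ∑ l ∈ listsOfLength W k, f (e :: l) := by
  rw [← Finset.sum_product']
  refine (Finset.sum_bij (fun p _ => p.1 :: p.2) ?_ ?_ ?_ ?_).symm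
  · intro p hp; simpa using hp
  · rintro ⟨a, l⟩ _ ⟨b, m⟩ _ h; simpa using h
  · intro l hl
    cases l with
    | nil => simp at hl
    | cons e l => exact ⟨(e, l), by simpa using hl, rfl⟩
  · intros; rfl

theorem ne_nil_of_le_length {a : List W} {k : ℕ} (h : k + 1 ≤ a.length) : a ≠ [] := by
  rintro rfl; simp at h

variable [Fintype V] [Fintype W]

namespace CStar

variable {E : DirectedGraph V W}

theorem S_mul_P (e : W) : S E e * P E (E.r e) = S E e :=
  mul_eq_self_of_star_mul_self ((isCKFamily E).proj _) ((isCKFamily E).star_mul_self e)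

theorem P_mul_S (e : W) : P E (E.s e) * S E e = S E e := by
  have h := congrArg (· * S E e) ((isCKFamily E).le e)
  simpa only [mul_assoc, (isCKFamily E).star_mul_self, S_mul_P] using h

theorem P_mul_S_of_ne {x : V} {e : W} (h : E.s e ≠ x) : P E x * S E e = 0 := by
  rw [← P_mul_S, ← mul_assoc, (isCKFamily E).orth _ _ h.symm, zero_mul]

theorem star_P (x : V) : star (P E x) = P E x := ((isCKFamily E).proj x).isSelfAdjoint

theorem P_mul_P (x : V) : P E x * P E x = P E x := ((isCKFamily E).proj x).isIdempotentElem

open Classical in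
theorem P_eq_sum (hs : E.NoSinks) (x : V) :
    P E x = ∑ e ∈ Finset.univ.filter (fun e => E.s e = x), S E e * star (S E e) :=
  (isCKFamily E).sum_eq x (hs x)

theorem sum_S_mul_star (hs : E.NoSinks) : ∑ e, S E e * star (S E e) = 1 := by
  classical
  rw [(isCKFamily E).unit, ← Finset.sum_fiberwise (g := E.s)]
  exact Finset.sum_congr rfl fun x _ => (P_eq_sum hs x).symm

/-- The product `S_{e₁} ⋯ S_{e_k}` of a list of edges. -/
noncomputable def word (E : DirectedGraph V W) (l : List W) : CStar E := (l.map (S E)).prod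

@[simp] theorem word_nil : word E [] = 1 := rfl

theorem word_cons (e : W) (l : List W) : word E (e :: l) = S E e * word E l := by
  simp [word]

@[simp] theorem word_singleton (e : W) : word E [e] = S E e := by simp [word]

theorem word_append (a b : List W) : word E (a ++ b) = word E a * word E b := by
  simp [word]

/-- Summing over all lists rather than over paths is harmless, because the word of a list that is
not a path vanishes. The empty list gives 1, not a vertex projection. -/
theorem sum_word_mul_star (hs : E.NoSinks) (k : ℕ) :
    ∑ l ∈ listsOfLength W k, word E l * star (word E l) = 1 := by
  induction k with
  | zero => rw [sum_listsOfLength_zero]; simp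
  | succ k ih =>
    rw [sum_listsOfLength_succ, ← sum_S_mul_star hs]
    refine Finset.sum_congr rfl fun e _ => ?_
    have : ∀ l, word E (e :: l) * star (word E (e :: l)) =
        S E e * (word E l * star (word E l)) * star (S E e) := fun l => by
      rw [word_cons, star_mul]; noncomm_ring
    simp only [this]
    rw [← Finset.sum_mul, ← Finset.mul_sum, ih, mul_one]

theorem P_mul_word_cons (x : V) (e : W) (l : List W) :
    P E x * word E (e :: l) = word E (e :: l) ∨ P E x * word E (e :: l) = 0 := by
  rw [word_cons, ← mul_assoc]
  by_cases h : E.s e = x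
  · left; rw [← h, P_mul_S]
  · right; rw [P_mul_S_of_ne h, zero_mul]

theorem P_mul_word (x : V) {l : List W} (hl : l ≠ []) :
    P E x * word E l = word E l ∨ P E x * word E l = 0 := by
  cases l with
  | nil => exact absurd rfl hl
  | cons e l => exact P_mul_word_cons x e l

/-- Peel off equal first letters: S_e⋆ S_e is a vertex projection, which fixes or kills the rest. As
the lengths agree, two distinct letters eventually meet. -/
theorem star_word_mul_word {a b : List W} (hlen : a.length = b.length) (hab : a ≠ b) :
    star (word E a) * word E b = 0 := by
  induction a generalizing b with
  | nil => exact absurd (List.length_eq_zero_iff.1 hlen.symm).symm hab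
  | cons e a ih =>
    cases b with
    | nil => simp at hlen
    | cons f b =>
      have hlen' : a.length = b.length := by simpa using hlen
      rw [word_cons, word_cons, star_mul, mul_assoc, ← mul_assoc (star (S E e))]
      by_cases hef : e = f
      · subst hef
        have hab' : a ≠ b := fun h => hab (by rw [h])
        rw [(isCKFamily E).star_mul_self]
        have hb : b ≠ [] := by
          rintro rfl
          exact hab' (List.length_eq_zero_iff.1 hlen')
        rcases P_mul_word (E.r e) hb with h | h <;> rw [h]
        · exact ih hlen' hab'
        · exact mul_zero _
      · rw [(isCKFamily E).star_mul _ _ hef, zero_mul, mul_zero]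

/-- The empty list is excluded because its word is 1; the `+ 1` in the word lengths chosen later
serves to avoid it. -/
theorem star_word_mul_self {l : List W} (hl : l ≠ []) :
    word E l = 0 ∨ ∃ x, star (word E l) * word E l = P E x := by
  induction l with
  | nil => exact absurd rfl hl
  | cons e l ih =>
    by_cases h : l = []
    · subst h
      exact Or.inr ⟨E.r e, by rw [word_singleton, (isCKFamily E).star_mul_self]⟩
    · have h1 : star (word E (e :: l)) * word E (e :: l) =
          star (word E l) * (P E (E.r e) * word E l) := by
        rw [word_cons, star_mul, ← (isCKFamily E).star_mul_self]; noncomm_ring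
      rcases P_mul_word (E.r e) h with h2 | h2
      · rw [h2] at h1
        rcases ih h with h3 | ⟨x, hx⟩
        · left; rw [word_cons, h3, mul_zero]
        · exact Or.inr ⟨x, h1.trans hx⟩
      · left
        rw [h2, mul_zero] at h1
        exact CStarRing.star_mul_self_eq_zero_iff _ |>.1 h1

theorem word_mul_P {l : List W} {x : V} (h : star (word E l) * word E l = P E x) :
    word E l * P E x = word E l :=
  mul_eq_self_of_star_mul_self ((isCKFamily E).proj x) h

theorem norm_P_le (x : V) : ‖P E x‖ ≤ 1 := ((isCKFamily E).proj x).norm_le _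

theorem one_le_norm_P (hs : E.NoSinks) (x : V) : 1 ≤ ‖P E x‖ :=
  ((isCKFamily E).proj x).one_le_norm (P_ne_zero hs x)

theorem norm_word_le (l : List W) : ‖word E l‖ ≤ 1 := by
  induction l with
  | nil => exact (IsStarProjection.one (CStar E)).norm_le _
  | cons e l ih =>
    have h : ‖S E e‖ ≤ 1 := by
      have h1 : ‖S E e‖ * ‖S E e‖ ≤ 1 := by
        rw [← CStarRing.norm_star_mul_self, (isCKFamily E).star_mul_self]
        exact norm_P_le _
      by_contra h
      nlinarith
    rw [word_cons]
    exact (norm_mul_le _ _).trans (mul_le_one₀ h (norm_nonneg _) ih)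

theorem norm_star_word_mul_mul_le (a b : List W) (x : CStar E) :
    ‖star (word E a) * x * word E b‖ ≤ ‖x‖ := by
  have h1 := norm_word_le (E := E) a
  have h2 := norm_word_le (E := E) b
  calc ‖star (word E a) * x * word E b‖ ≤ ‖star (word E a)‖ * ‖x‖ * ‖word E b‖ :=
        (norm_mul_le _ _).trans (mul_le_mul_of_nonneg_right (norm_mul_le _ _) (norm_nonneg _))
    _ ≤ 1 * ‖x‖ * 1 := by
        rw [norm_star]; gcongr
    _ = ‖x‖ := by ring

/-- Raising the level of a word: `S_a S_b⋆ = ∑_c S_{ac} S_{bc}⋆`. -/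
theorem word_mul_star_word (hs : E.NoSinks) (a b : List W) (k : ℕ) :
    word E a * star (word E b) =
      ∑ c ∈ listsOfLength W k, word E (a ++ c) * star (word E (b ++ c)) := by
  calc word E a * star (word E b) = word E a * 1 * star (word E b) := by rw [mul_one]
    _ = _ := by
      rw [← sum_word_mul_star hs k, Finset.mul_sum, Finset.sum_mul]
      refine Finset.sum_congr rfl fun c _ => ?_
      rw [word_append, word_append, star_mul]; noncomm_ring

/-- The initial projections `S_a⋆ S_a S_b⋆ S_b` of two words together. -/
noncomputable def initProj (E : DirectedGraph V W) (a b : List W) : CStar E :=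
  star (word E a) * word E a * (star (word E b) * word E b)

theorem initProj_eq {a b : List W} (ha : a ≠ []) (hb : b ≠ []) :
    initProj E a b = 0 ∨ ∃ x, star (word E a) * word E a = P E x ∧
      star (word E b) * word E b = P E x ∧ initProj E a b = P E x := by
  unfold initProj
  rcases star_word_mul_self (E := E) ha with h | ⟨x, hx⟩
  · left; rw [h]; simp
  rcases star_word_mul_self (E := E) hb with h | ⟨y, hy⟩
  · left; rw [h]; simp
  by_cases hxy : x = y
  · subst hxy
    right
    exact ⟨x, hx, hy, by rw [hx, hy, P_mul_P]⟩
  · left; rw [hx, hy, (isCKFamily E).orth x y hxy]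

theorem initProj_eq' {a b : List W} (ha : a ≠ []) (hb : b ≠ []) :
    initProj E a b = 0 ∨ ∃ x, initProj E a b = P E x :=
  (initProj_eq ha hb).imp id fun ⟨x, _, _, h⟩ => ⟨x, h⟩

/-- The linear span of the words `S_a S_b⋆` of degree `d`. -/
noncomputable def wordSpan (E : DirectedGraph V W) (R : Type*) [Semiring R]
    [Module R (CStar E)] (d : ℤ) : Submodule R (CStar E) :=
  Submodule.span R {x | ∃ a b : List W, (a.length : ℤ) - b.length = d ∧
    x = word E a * star (word E b)}

/-! ### Spans of words of a given degree, over ℕ and over ℂ -/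

section WordSpan

variable {R : Type*} [Semiring R] [Module R (CStar E)]

theorem word_mem_wordSpan (a b : List W) {d : ℤ} (h : (a.length : ℤ) - b.length = d) :
    word E a * star (word E b) ∈ wordSpan E R d := Submodule.subset_span ⟨a, b, h, rfl⟩

theorem one_mem_wordSpan : (1 : CStar E) ∈ wordSpan E R 0 := by
  simpa using word_mem_wordSpan (E := E) (R := R) [] [] (d := 0) (by simp)

theorem S_mem_wordSpan (e : W) : S E e ∈ wordSpan E R 1 := by
  simpa using word_mem_wordSpan (E := E) (R := R) [e] [] (d := 1) (by simp)

theorem P_mem_wordSpan (hs : E.NoSinks) (x : V) : P E x ∈ wordSpan E R 0 := by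
  rw [P_eq_sum hs]
  refine Submodule.sum_mem _ fun e _ => ?_
  simpa using word_mem_wordSpan (E := E) (R := R) [e] [e] (d := 0) (by simp)

end WordSpan

theorem natSpan_le (d : ℤ) {x : CStar E} (hx : x ∈ wordSpan E ℕ d) : x ∈ wordSpan E ℂ d := by
  induction hx using Submodule.span_induction with
  | mem x h => exact Submodule.subset_span h
  | zero => exact Submodule.zero_mem _
  | add x y _ _ hx hy => exact Submodule.add_mem _ hx hy
  | smul n x _ hx => exact nsmul_mem hx n

theorem star_mem_wordSpan {d : ℤ} {x : CStar E} (hx : x ∈ wordSpan E ℕ d) :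
    star x ∈ wordSpan E ℕ (-d) := by
  induction hx using Submodule.span_induction with
  | mem x h =>
    obtain ⟨a, b, h, rfl⟩ := h
    rw [star_mul, star_star]
    exact word_mem_wordSpan b a (by omega)
  | zero => simp
  | add x y _ _ hx hy => rw [star_add]; exact Submodule.add_mem _ hx hy
  | smul n x _ hx => rw [star_nsmul]; exact nsmul_mem hx n

/-- S_b⋆ S_c vanishes unless b is a prefix of c; then, for nonempty b, a vertex projection is left,
which fixes or kills the rest of c. If no rest is left, that projection must itself be written with
words, as ∑ S_e S_e⋆. -/
theorem word_mul_word_mem_aux (hs : E.NoSinks) (a b c d : List W) (h : b.length ≤ c.length)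
    {k : ℤ} (hk : ((a.length : ℤ) - b.length) + (c.length - d.length) = k) :
    word E a * star (word E b) * (word E c * star (word E d)) ∈ wordSpan E ℕ k := by
  obtain ⟨c₁, c₂, rfl, hlen⟩ : ∃ c₁ c₂, c = c₁ ++ c₂ ∧ b.length = c₁.length :=
    ⟨c.take b.length, c.drop b.length, (List.take_append_drop _ _).symm, by simp [h]⟩
  rw [word_append]
  have h1 : word E a * star (word E b) * (word E c₁ * word E c₂ * star (word E d)) =
      word E a * ((star (word E b) * word E c₁) * word E c₂) * star (word E d) := by
    noncomm_ring
  rw [h1]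
  by_cases hbc : b = c₁
  swap
  · rw [star_word_mul_word hlen hbc]; simp
  subst hbc
  simp only [List.length_append, Nat.cast_add] at hk
  have h2 : word E a * word E c₂ * star (word E d) ∈ wordSpan E ℕ k := by
    rw [← word_append]
    exact word_mem_wordSpan _ _ (by simp; omega)
  rcases eq_or_ne b [] with rfl | hb
  · simpa using h2
  rcases star_word_mul_self (E := E) hb with h3 | ⟨x, hx⟩
  · rw [h3]; simp
  rw [hx]
  rcases eq_or_ne c₂ [] with rfl | hc
  · rw [word_nil, mul_one, P_eq_sum hs, Finset.mul_sum, Finset.sum_mul]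
    refine Submodule.sum_mem _ fun e _ => ?_
    have := word_mem_wordSpan (E := E) (R := ℕ) (a ++ [e]) (d ++ [e]) (d := k)
      (by simp at hk ⊢; omega)
    rw [word_append, word_append, star_mul] at this
    simpa only [word_singleton, mul_assoc] using this
  · rcases P_mul_word (E := E) x hc with h4 | h4 <;> rw [h4]
    · exact h2
    · simp

theorem word_mul_word_mem (hs : E.NoSinks) (a b c d : List W)
    {k : ℤ} (hk : ((a.length : ℤ) - b.length) + (c.length - d.length) = k) :
    word E a * star (word E b) * (word E c * star (word E d)) ∈ wordSpan E ℕ k := by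
  rcases le_total b.length c.length with h | h
  · exact word_mul_word_mem_aux hs a b c d h hk
  · have := star_mem_wordSpan (word_mul_word_mem_aux hs d c b a h (k := -k) (by omega))
    simpa [mul_assoc] using this

theorem mul_mem_wordSpan (hs : E.NoSinks) {d d' : ℤ} {x y : CStar E} (hx : x ∈ wordSpan E ℕ d)
    (hy : y ∈ wordSpan E ℕ d') : x * y ∈ wordSpan E ℕ (d + d') := by
  induction hx using Submodule.span_induction with
  | mem x h =>
    obtain ⟨a, b, h, rfl⟩ := h
    induction hy using Submodule.span_induction with
    | mem y h' =>
      obtain ⟨a', b', h', rfl⟩ := h'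
      exact word_mul_word_mem hs a b a' b' (by omega)
    | zero => simp
    | add x y _ _ hx hy => rw [mul_add]; exact Submodule.add_mem _ hx hy
    | smul n x _ hx => rw [mul_smul_comm]; exact nsmul_mem hx n
  | zero => simp
  | add x y _ _ hx hy => rw [add_mul]; exact Submodule.add_mem _ hx hy
  | smul n x _ hx => rw [smul_mul_assoc]; exact nsmul_mem hx n

theorem word_mem_natSpan (a : List W) : word E a ∈ wordSpan E ℕ a.length := by
  simpa using word_mem_wordSpan (E := E) (R := ℕ) a [] (d := a.length) (by simp)

/-! ### Matrix coefficients -/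

theorem eq_sum_compress (hs : E.NoSinks) (m n : ℕ) (x : CStar E) :
    x = ∑ a ∈ listsOfLength W m, ∑ b ∈ listsOfLength W n,
      word E a * (star (word E a) * x * word E b) * star (word E b) :=
  calc x = (∑ a ∈ listsOfLength W m, word E a * star (word E a)) * x *
          ∑ b ∈ listsOfLength W n, word E b * star (word E b) := by
          rw [sum_word_mul_star hs, sum_word_mul_star hs, one_mul, mul_one]
    _ = _ := by
      rw [Finset.sum_mul, Finset.sum_mul]
      refine Finset.sum_congr rfl fun a _ => ?_
      rw [Finset.mul_sum]
      refine Finset.sum_congr rfl fun b _ => ?_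
      noncomm_ring

/-- An element is determined by its compressions `S_a⋆ x S_b`. -/
theorem ext_of_compress (hs : E.NoSinks) (m n : ℕ) {x y : CStar E}
    (h : ∀ a b : List W, a.length = m → b.length = n →
      star (word E a) * x * word E b = star (word E a) * y * word E b) : x = y := by
  rw [eq_sum_compress hs m n x, eq_sum_compress hs m n y]
  refine Finset.sum_congr rfl fun a ha => Finset.sum_congr rfl fun b hb => ?_
  rw [h a b (mem_listsOfLength.1 ha) (mem_listsOfLength.1 hb)]

/-- Raise S_{a'} S_{b'}⋆ to the level of a and b. By orthogonality only those c with a = a'c and b =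
b'c contribute, so the multiplicity is their number. -/
theorem compress_word (hs : E.NoSinks) {a b a' b' : List W} {j : ℕ}
    (ha : a.length = a'.length + j) (hb : b.length = b'.length + j) :
    ∃ n : ℕ, star (word E a) * (word E a' * star (word E b')) * word E b =
      n • initProj E a b := by
  classical
  refine ⟨((listsOfLength W j).filter (fun c => a = a' ++ c ∧ b = b' ++ c)).card, ?_⟩
  rw [word_mul_star_word hs a' b' j, Finset.mul_sum, Finset.sum_mul, ← Finset.sum_const,
    Finset.sum_filter]
  refine Finset.sum_congr rfl fun c hc => ?_
  have hc' := mem_listsOfLength.1 hc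
  have h1 : star (word E a) * (word E (a' ++ c) * star (word E (b' ++ c))) * word E b =
    (star (word E a) * word E (a' ++ c)) * (star (word E (b' ++ c)) * word E b) := by noncomm_ring
  rw [h1]
  split_ifs with h
  · rw [← h.1, ← h.2]; rfl
  · rw [not_and_or] at h
    rcases h with h | h
    · rw [star_word_mul_word (by simp [ha, hc']) h, zero_mul]
    · rw [star_word_mul_word (by simp [hb, hc']) (Ne.symm h), mul_zero]

/-- High compressions of an element of degree `d` are scalar. -/
theorem compress_mem {R : Type*} [CommSemiring R] [Algebra R (CStar E)]
    (hs : E.NoSinks) {d : ℤ} {x : CStar E} (hx : x ∈ wordSpan E R d) :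
    ∃ N : ℕ, ∀ a b : List W, N ≤ a.length → N ≤ b.length → (a.length : ℤ) - b.length = d →
      ∃ c : R, star (word E a) * x * word E b = c • initProj E a b := by
  induction hx using Submodule.span_induction with
  | mem x h =>
    obtain ⟨a', b', h, rfl⟩ := h
    refine ⟨a'.length, fun a b ha hb hab => ?_⟩
    obtain ⟨n, hn⟩ := compress_word hs (a := a) (b := b) (a' := a') (b' := b')
      (j := a.length - a'.length) (by omega) (by omega)
    exact ⟨n, by rw [hn, Nat.cast_smul_eq_nsmul]⟩
  | zero => exact ⟨0, fun a b _ _ _ => ⟨0, by simp⟩⟩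
  | add x y _ _ hx hy =>
    obtain ⟨N, hN⟩ := hx
    obtain ⟨M, hM⟩ := hy
    refine ⟨max N M, fun a b ha hb hab => ?_⟩
    obtain ⟨c, hc⟩ := hN a b (by omega) (by omega) hab
    obtain ⟨c', hc'⟩ := hM a b (by omega) (by omega) hab
    exact ⟨c + c', by rw [mul_add, add_mul, hc, hc', add_smul]⟩
  | smul r x _ hx =>
    obtain ⟨N, hN⟩ := hx
    refine ⟨N, fun a b ha hb hab => ?_⟩
    obtain ⟨c, hc⟩ := hN a b ha hb hab
    exact ⟨r * c, by rw [mul_smul_comm, smul_mul_assoc, hc, smul_smul]⟩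

/-- Integrality: two sums of words of degree `0` at distance less than `1` agree. -/
theorem eq_of_norm_sub_lt (hs : E.NoSinks) {x y : CStar E} (hx : x ∈ wordSpan E ℕ 0)
    (hy : y ∈ wordSpan E ℕ 0) (h : ‖x - y‖ < 1) : x = y := by
  obtain ⟨N, hN⟩ := compress_mem hs hx
  obtain ⟨M, hM⟩ := compress_mem hs hy
  refine ext_of_compress hs (N + M + 1) (N + M + 1) fun a b ha hb => ?_
  obtain ⟨m, hm⟩ := hN a b (by omega) (by omega) (by omega)
  obtain ⟨n, hn⟩ := hM a b (by omega) (by omega) (by omega)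
  rw [hm, hn]
  rcases initProj_eq' (E := E) (ne_nil_of_le_length (k := 0) (a := a) (by omega))
    (ne_nil_of_le_length (k := 0) (a := b) (by omega)) with h0 | ⟨v, hv⟩
  · rw [h0]; simp
  have h1 : star (word E a) * (x - y) * word E b = ((m : ℂ) - n) • P E v := by
    rw [mul_sub, sub_mul, hm, hn, hv, sub_smul, Nat.cast_smul_eq_nsmul, Nat.cast_smul_eq_nsmul]
  have h2 := (norm_star_word_mul_mul_le a b (x - y)).trans_lt h
  rw [h1, norm_smul] at h2
  have h3 := one_le_norm_P hs v
  have h4 : ‖(m : ℂ) - n‖ < 1 := by nlinarith [norm_nonneg ((m : ℂ) - n)]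
  have h5 : |(m : ℤ) - n| < 1 := by
    have : ((m : ℂ) - n) = (((m : ℤ) - n : ℤ) : ℂ) := by push_cast; rfl
    rw [this, Complex.norm_intCast] at h4
    exact_mod_cast h4
  have h6 : m = n := by rw [Int.abs_lt_one_iff] at h5; omega
  rw [h6]

/-- Integrality: a sum of words of degree `0` close to a multiple of a vertex projection is a
natural multiple of it. -/
theorem exists_eq_nsmul_P (hs : E.NoSinks) {x : CStar E} (hx : x ∈ wordSpan E ℕ 0) (v : V)
    (c : ℂ) (h : ‖x - c • P E v‖ < 1 / 4) : ∃ n : ℕ, x = n • P E v := by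
  obtain ⟨N, hN⟩ := compress_mem hs hx
  -- The integer nearest to Re c. Where the compression of P_v is present, the coefficient m
  -- satisfies |m − c| < 1/4 and equals this integer; elsewhere |m| < 1/4 forces m = 0.
  refine ⟨⌊c.re + 1 / 2⌋₊, ext_of_compress hs (N + 1) (N + 1) fun a b ha hb => ?_⟩
  obtain ⟨m, hm⟩ := hN a b (by omega) (by omega) (by omega)
  have hb' : b ≠ [] := ne_nil_of_le_length (k := 0) (by omega)
  have ha' : a ≠ [] := ne_nil_of_le_length (k := 0) (by omega)
  have hk : ∃ k : ℕ, k ≤ 1 ∧ star (word E a) * P E v * word E b = k • initProj E a b := by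
    rw [mul_assoc]
    rcases P_mul_word (E := E) v hb' with h1 | h1 <;> rw [h1]
    · by_cases hab : a = b
      · refine ⟨1, le_rfl, ?_⟩
        subst hab
        rcases initProj_eq (E := E) ha' ha' with h2 | ⟨x, h2, _, h3⟩
        · rw [h2, smul_zero]
          rcases star_word_mul_self (E := E) ha' with h4 | ⟨y, hy⟩
          · rw [h4, mul_zero]
          · rw [initProj, hy, P_mul_P] at h2
            rw [hy, h2]
        · rw [h2, h3, one_smul]
      · exact ⟨0, zero_le_one, by rw [star_word_mul_word (by omega) hab, zero_smul]⟩
    · exact ⟨0, zero_le_one, by rw [mul_zero, zero_smul]⟩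
  obtain ⟨k, hk1, hk⟩ := hk
  rw [hm, mul_smul_comm, smul_mul_assoc, hk, smul_smul]
  rcases initProj_eq' (E := E) ha' hb' with h0 | ⟨y, hy⟩
  · rw [h0]; simp
  have h1 : star (word E a) * (x - c • P E v) * word E b = ((m : ℂ) - c * k) • P E y := by
    rw [mul_sub, sub_mul, hm, mul_smul_comm, smul_mul_assoc, hk, hy, sub_smul,
      Nat.cast_smul_eq_nsmul, ← smul_smul, Nat.cast_smul_eq_nsmul]
  have h2 := (norm_star_word_mul_mul_le a b (x - c • P E v)).trans_lt h
  rw [h1, norm_smul] at h2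
  have h3 := one_le_norm_P hs y
  have h4 : ‖(m : ℂ) - c * k‖ < 1 / 4 := by nlinarith [norm_nonneg ((m : ℂ) - c * k)]
  have h5 := (Complex.abs_re_le_norm _).trans_lt h4
  rw [abs_lt] at h5
  congr 1
  interval_cases k
  · simp at h5
    have : (m : ℝ) < 1 := by linarith
    have : m < 1 := by exact_mod_cast this
    omega
  · simp at h5
    rw [mul_one, eq_comm, Nat.floor_eq_iff (by linarith [m.cast_nonneg (α := ℝ)])]
    constructor <;> linarith

/-! ### Homogeneous approximation -/

theorem gauge_P (z : Circle) (x : V) : gauge E z (P E x) = P E x := lift_P _ x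

theorem gauge_S (z : Circle) (e : W) : gauge E z (S E e) = (z : ℂ) • S E e := lift_S _ e

theorem gauge_comp (z z' : Circle) : (gauge E z).comp (gauge E z') = gauge E (z * z') := by
  refine hom_ext (fun x => ?_) fun e => ?_
  · rw [StarAlgHom.comp_apply, gauge_P, gauge_P, gauge_P]
  · rw [StarAlgHom.comp_apply, gauge_S, map_smul, gauge_S, gauge_S, smul_smul, mul_comm,
      Circle.coe_mul]

theorem gauge_one : gauge E 1 = StarAlgHom.id ℂ (CStar E) := by
  refine hom_ext (fun x => gauge_P 1 x) fun e => ?_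
  rw [gauge_S, Circle.coe_one, one_smul]; rfl

theorem norm_gauge_le (z : Circle) (x : CStar E) : ‖gauge E z x‖ ≤ ‖x‖ :=
  NonUnitalStarAlgHom.norm_apply_le (gauge E z) x

theorem gauge_word (z : Circle) (l : List W) :
    gauge E z (word E l) = (z : ℂ) ^ l.length • word E l := by
  induction l with
  | nil => simp
  | cons e l ih =>
    rw [word_cons, map_mul, gauge_S, ih, smul_mul_smul_comm, List.length_cons, pow_succ']

theorem gauge_eq_smul (z : Circle) {d : ℤ} {x : CStar E} (hx : x ∈ wordSpan E ℂ d) :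
    gauge E z x = (z : ℂ) ^ d • x := by
  induction hx using Submodule.span_induction with
  | mem x h =>
    obtain ⟨a, b, rfl, rfl⟩ := h
    have hz : (z : ℂ) ≠ 0 := Circle.coe_ne_zero z
    have hz' : star (z : ℂ) = (z : ℂ)⁻¹ := by
      rw [← Circle.coe_inv, Circle.coe_inv_eq_conj]; rfl
    rw [map_mul, map_star, gauge_word, gauge_word, star_smul, smul_mul_smul_comm, star_pow, hz',
      zpow_sub₀ hz, zpow_natCast, zpow_natCast, inv_pow, div_eq_mul_inv]
  | zero => simp
  | add x y _ _ hx hy => rw [map_add, hx, hy, smul_add]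
  | smul c x _ hx => rw [map_smul, hx, smul_comm]

theorem mul_mem_iSup_wordSpan (hs : E.NoSinks) {d : ℤ} {z x : CStar E}
    (hz : z ∈ wordSpan E ℕ d) (hx : x ∈ ⨆ d, wordSpan E ℂ d) :
    z * x ∈ ⨆ d, wordSpan E ℂ d := by
  induction hx using Submodule.iSup_induction' with
  | mem i x hx =>
    induction hx using Submodule.span_induction with
    | mem x h =>
      obtain ⟨a, b, h, rfl⟩ := h
      exact Submodule.mem_iSup_of_mem _
        (natSpan_le _ (mul_mem_wordSpan hs hz (word_mem_wordSpan a b h)))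
    | zero => simp
    | add x y _ _ hx hy => rw [mul_add]; exact Submodule.add_mem _ hx hy
    | smul c x _ hx => rw [mul_smul_comm]; exact Submodule.smul_mem _ c hx
  | zero => simp
  | add x y _ _ hx hy => rw [mul_add]; exact Submodule.add_mem _ hx hy

theorem star_S_mem_wordSpan (e : W) : star (S E e) ∈ wordSpan E ℕ (-1) :=
  star_mem_wordSpan (S_mem_wordSpan e)

/-- The linear combinations of words `S_a S_b⋆` are dense. -/
theorem exists_norm_sub_lt (hs : E.NoSinks) (x : CStar E) {ε : ℝ} (hε : 0 < ε) :
    ∃ y ∈ ⨆ d, wordSpan E ℂ d, ‖x - y‖ < ε := by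
  have h : x ∈ closure ((⨆ d, wordSpan E ℂ d : Submodule ℂ (CStar E)) : Set (CStar E)) := by
    induction x using dense with
    | hC => exact isClosed_closure
    | h x =>
      apply subset_closure
      change of E x ∈ ⨆ d, wordSpan E ℂ d
      induction x using FreeStarAlg.induct with
      | one => rw [of_one]; exact Submodule.mem_iSup_of_mem 0 one_mem_wordSpan
      | mul a x hx =>
        rw [of_mul]
        cases a with
        | vert v => exact mul_mem_iSup_wordSpan hs (P_mem_wordSpan hs v) hx
        | edge e => exact mul_mem_iSup_wordSpan hs (S_mem_wordSpan e) hx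
        | edgeStar e =>
          have ha : of E (FreeStarAlg.letter E (.edgeStar e)) = star (S E e) := by
            rw [S, ← of_star]; exact congrArg (of E) (FreeStarAlg.star_letter E (.edge e)).symm
          rw [ha]
          exact mul_mem_iSup_wordSpan hs (star_S_mem_wordSpan e) hx
      | add x y hx hy => rw [of_add]; exact Submodule.add_mem _ hx hy
      | smul c x hx => rw [of_smul]; exact Submodule.smul_mem _ c hx
  obtain ⟨y, hy, hxy⟩ := Metric.mem_closure_iff.1 h ε hε
  exact ⟨y, hy, by rwa [← dist_eq_norm]⟩

theorem gauge_pow_of_eq_smul {z : Circle} {c : ℂ} {w : CStar E} (h : gauge E z w = c • w)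
    (k : ℕ) : gauge E (z ^ k) w = c ^ k • w := by
  induction k with
  | zero => rw [pow_zero, gauge_one]; simp
  | succ k ih =>
    rw [pow_succ, ← gauge_comp, StarAlgHom.comp_apply, h, map_smul, ih, smul_smul, pow_succ']

/-- Averaging over a finite group of roots of unity replaces an approximation of an eigenvector of
the gauge action by a homogeneous one. -/
theorem exists_homogeneous {y : CStar E} (hy : y ∈ ⨆ d, wordSpan E ℂ d) :
    ∃ z : Circle, ∀ (w : CStar E) (c : ℂ), w ≠ 0 → gauge E z w = c • w →
      ∃ d, ∃ y' ∈ wordSpan E ℂ d, ‖w - y'‖ ≤ ‖w - y‖ ∧ (c = 1 → d = 0) := by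
  obtain ⟨f, hf, rfl⟩ := (Submodule.mem_iSup_iff_exists_finsupp _ _).1 hy
  obtain ⟨M, hM⟩ : ∃ M : ℕ, ∀ d ∈ f.support, d.natAbs ≤ M :=
    ⟨f.support.sup Int.natAbs, fun d hd => Finset.le_sup (f := Int.natAbs) hd⟩
  -- For N > 2M a primitive N-th root of unity ζ has distinct powers ζ^d for |d| ≤ M, so a finite
  -- average separates the degrees of y and replaces integration over the circle.
  obtain ⟨N, hN⟩ : ∃ N : ℕ, N = 2 * M + 1 := ⟨_, rfl⟩
  have hN0 : N ≠ 0 := by omega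
  have hprim := Complex.isPrimitiveRoot_exp N hN0
  set ζ := Complex.exp (2 * Real.pi * Complex.I / N) with hζ
  have hnorm : ‖ζ‖ = 1 := hprim.norm'_eq_one hN0
  let z : Circle := ⟨ζ, mem_sphere_zero_iff_norm.2 hnorm⟩
  have hz : (z : ℂ) = ζ := rfl
  have hζ0 : ζ ≠ 0 := hprim.ne_zero hN0
  refine ⟨z, fun w c hw hwc => ?_⟩
  have hcN : c ^ N = 1 := by
    have h1 := gauge_pow_of_eq_smul hwc N
    have h2 : z ^ N = 1 := by
      ext; rw [Circle.coe_pow, hz, hprim.pow_eq_one, Circle.coe_one]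
    rw [h2, gauge_one] at h1
    have h3 : (c ^ N - 1) • w = 0 := by
      rw [sub_smul, one_smul, ← h1]; exact sub_self w
    exact sub_eq_zero.1 ((smul_eq_zero.1 h3).resolve_right hw)
  have hc0 : c ≠ 0 := by rintro rfl; simp [hN0] at hcN
  have hc1 : ‖c‖ = 1 := by
    have : ‖c‖ ^ N = 1 := by rw [← norm_pow, hcN, norm_one]
    exact (pow_eq_one_iff_of_nonneg (norm_nonneg c) hN0).1 this
  -- The spectral projection of γ_z for the eigenvalue c: a contraction that fixes w, keeps the
  -- degrees d with ζ^d = c and kills the others.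
  let B : CStar E →ₗ[ℂ] CStar E := (N : ℂ)⁻¹ • ∑ k ∈ Finset.range N,
    (c⁻¹ ^ k) • (gauge E (z ^ k)).toAlgHom.toLinearMap
  have hB : ∀ x, B x = (N : ℂ)⁻¹ • ∑ k ∈ Finset.range N, (c⁻¹ ^ k) • gauge E (z ^ k) x := by
    intro x
    simp only [B, LinearMap.smul_apply, LinearMap.sum_apply]
    rfl
  have hBn : ∀ x, ‖B x‖ ≤ ‖x‖ := by
    intro x
    rw [hB, norm_smul, norm_inv, Complex.norm_natCast]
    have h1 : ‖∑ k ∈ Finset.range N, (c⁻¹ ^ k) • gauge E (z ^ k) x‖ ≤ N * ‖x‖ := by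
      refine (norm_sum_le _ _).trans ?_
      refine (Finset.sum_le_card_nsmul _ _ ‖x‖ fun k _ => ?_).trans (by simp)
      rw [norm_smul, norm_pow, norm_inv, hc1, inv_one, one_pow, one_mul]
      exact norm_gauge_le _ _
    have h2 : (0 : ℝ) < N := by positivity
    rw [inv_mul_le_iff₀ h2]
    exact h1
  have hN0' : (N : ℂ) ≠ 0 := by exact_mod_cast hN0
  have hBw : B w = w := by
    rw [hB]
    have : ∀ k ∈ Finset.range N, (c⁻¹ ^ k) • gauge E (z ^ k) w = w := fun k _ => by
      rw [gauge_pow_of_eq_smul hwc, smul_smul, ← mul_pow, inv_mul_cancel₀ hc0, one_pow, one_smul]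
    rw [Finset.sum_congr rfl this, Finset.sum_const, Finset.card_range, ← Nat.cast_smul_eq_nsmul ℂ,
      smul_smul, inv_mul_cancel₀ hN0', one_smul]
  have hBx : ∀ d, ∀ x ∈ wordSpan E ℂ d, B x = if ζ ^ d = c then x else 0 := by
    intro d x hx
    have h1 : ∀ k ∈ Finset.range N, (c⁻¹ ^ k) • gauge E (z ^ k) x = (c⁻¹ * ζ ^ d) ^ k • x := by
      intro k _
      rw [gauge_eq_smul _ hx, smul_smul, mul_pow, Circle.coe_pow, hz]
      congr 2
      rw [← zpow_natCast, ← zpow_natCast, ← zpow_mul, ← zpow_mul, mul_comm]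
    rw [hB, Finset.sum_congr rfl h1, ← Finset.sum_smul, smul_smul]
    split_ifs with h
    · rw [h, inv_mul_cancel₀ hc0]; simp [hN0']
    · have h2 : c⁻¹ * ζ ^ d ≠ 1 := fun h2 => h (by
        rw [inv_mul_eq_one₀ hc0] at h2; exact h2.symm)
      have h3 : (c⁻¹ * ζ ^ d) ^ N = 1 := by
        rw [mul_pow, inv_pow, hcN, inv_one, one_mul, ← zpow_natCast, ← zpow_mul, mul_comm,
          zpow_mul, zpow_natCast, hprim.pow_eq_one, one_zpow]
      rw [geom_sum_eq h2, h3, sub_self, zero_div, mul_zero, zero_smul]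
  have hBy : B (f.sum fun _ x => x) = ∑ d ∈ f.support, if ζ ^ d = c then f d else 0 := by
    rw [Finsupp.sum, map_sum]
    exact Finset.sum_congr rfl fun d _ => hBx d _ (hf d)
  have hbound : ‖w - B (f.sum fun _ x => x)‖ ≤ ‖w - f.sum fun _ x => x‖ := by
    have := hBn (w - f.sum fun _ x => x)
    rwa [map_sub, hBw] at this
  rw [hBy] at hbound
  by_cases hex : ∃ d ∈ f.support, ζ ^ d = c
  · obtain ⟨d, hd, hdc⟩ := hex
    have huniq : ∀ d' ∈ f.support, ζ ^ d' = c → d' = d := by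
      intro d' hd' h
      have h1 : ζ ^ (d' - d) = 1 := by rw [zpow_sub₀ hζ0, h, hdc, div_self hc0]
      have h2 := (hprim.zpow_eq_one_iff_dvd _).1 h1
      have h3 := hM d hd
      have h4 := hM d' hd'
      have h5 := Int.eq_zero_of_abs_lt_dvd h2 (by rw [abs_lt]; omega)
      omega
    refine ⟨d, f d, hf d, ?_, fun hc => ?_⟩
    · rw [Finset.sum_eq_single d, if_pos hdc] at hbound
      · exact hbound
      · intro d' hd' hne
        exact if_neg fun h => hne (huniq d' hd' h)
      · exact fun h => absurd hd h
    · have h2 := (hprim.zpow_eq_one_iff_dvd _).1 (hdc.trans hc)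
      have h3 := hM d hd
      exact Int.eq_zero_of_abs_lt_dvd h2 (by rw [abs_lt]; omega)
  -- No degree of y has eigenvalue c, so the average of y is 0, which may be given degree 0.
  · refine ⟨0, 0, Submodule.zero_mem _, ?_, fun _ => rfl⟩
    rwa [Finset.sum_eq_zero] at hbound
    intro d hd
    exact if_neg fun h => hex ⟨d, hd, h⟩

/-- An element that is an eigenvector of every gauge automorphism is close to a homogeneous linear
combination of words. -/
theorem exists_homogeneous_norm_sub_lt (hs : E.NoSinks) {w : CStar E} (hw0 : w ≠ 0)
    (hw : ∀ z, ∃ c : ℂ, gauge E z w = c • w) {ε : ℝ} (hε : 0 < ε) :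
    ∃ d, ∃ y ∈ wordSpan E ℂ d, ‖w - y‖ < ε := by
  obtain ⟨y, hy, hwy⟩ := exists_norm_sub_lt hs w hε
  obtain ⟨z, hz⟩ := exists_homogeneous hy
  obtain ⟨c, hc⟩ := hw z
  obtain ⟨d, y', hy', h, -⟩ := hz w c hw0 hc
  exact ⟨d, y', hy', h.trans_lt hwy⟩

/-- An element of the core is close to a linear combination of words of degree `0`. -/
theorem exists_norm_sub_lt_of_mem_core (hs : E.NoSinks) {w : CStar E} (hw : w ∈ core E) {ε : ℝ}
    (hε : 0 < ε) : ∃ y ∈ wordSpan E ℂ 0, ‖w - y‖ < ε := by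
  rcases eq_or_ne w 0 with rfl | hw0
  · exact ⟨0, Submodule.zero_mem _, by simpa using hε⟩
  obtain ⟨y, hy, hwy⟩ := exists_norm_sub_lt hs w hε
  obtain ⟨z, hz⟩ := exists_homogeneous hy
  obtain ⟨d, y', hy', h, hd⟩ := hz w 1 hw0 (by rw [one_smul]; exact hw z)
  rw [hd rfl] at hy'
  exact ⟨y', hy', h.trans_lt hwy⟩

/-! ### Automorphisms that preserve sums of words -/

/-- The map sends the generators to sums of words of the same degree. -/
def IsIntegral (f : CStar E → CStar E) : Prop :=
  (∀ e, f (S E e) ∈ wordSpan E ℕ 1) ∧ ∀ x, f (P E x) ∈ wordSpan E ℕ 0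

section IsIntegral

variable {F : Type*} [FunLike F (CStar E) (CStar E)] [AlgHomClass F ℂ (CStar E) (CStar E)]
  {f : F}

theorem IsIntegral.map_word_mem (hs : E.NoSinks) (hf : IsIntegral (E := E) f) (l : List W) :
    f (word E l) ∈ wordSpan E ℕ l.length := by
  induction l with
  | nil => rw [word_nil, map_one]; exact one_mem_wordSpan
  | cons e l ih =>
    rw [word_cons, map_mul, List.length_cons, Nat.cast_add, add_comm, Nat.cast_one]
    exact mul_mem_wordSpan hs (hf.1 e) ih

theorem IsIntegral.map_mem [StarHomClass F (CStar E) (CStar E)] (hs : E.NoSinks)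
    (hf : IsIntegral (E := E) f) {d : ℤ} {x : CStar E} (hx : x ∈ wordSpan E ℕ d) :
    f x ∈ wordSpan E ℕ d := by
  induction hx using Submodule.span_induction with
  | mem x h =>
    obtain ⟨a, b, rfl, rfl⟩ := h
    rw [map_mul, map_star, sub_eq_add_neg]
    exact mul_mem_wordSpan hs (hf.map_word_mem hs a) (star_mem_wordSpan (hf.map_word_mem hs b))
  | zero => simp
  | add x y _ _ hx hy => rw [map_add]; exact Submodule.add_mem _ hx hy
  | smul n x _ hx => rw [map_nsmul]; exact nsmul_mem hx n

/-- Integral maps preserve the degrees of the generators, and γ_z acts in degree d as z^d. -/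
theorem IsIntegral.map_gauge {f : CStar E →⋆ₐ[ℂ] CStar E} (hf : IsIntegral (E := E) f)
    (z : Circle) (x : CStar E) : f (gauge E z x) = gauge E z (f x) := by
  have : f.comp (gauge E z) = (gauge E z).comp f := by
    refine hom_ext (fun x => ?_) fun e => ?_
    · rw [StarAlgHom.comp_apply, StarAlgHom.comp_apply, gauge_P,
        gauge_eq_smul z (natSpan_le _ (hf.2 x)), zpow_zero, one_smul]
    · rw [StarAlgHom.comp_apply, StarAlgHom.comp_apply, gauge_S, map_smul,
        gauge_eq_smul z (natSpan_le _ (hf.1 e)), zpow_one]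
  exact DFunLike.congr_fun this x

theorem IsIntegral.equiv_map_gauge {h : CStar E ≃⋆ₐ[ℂ] CStar E} (hf : IsIntegral (E := E) h)
    (z : Circle) (x : CStar E) : h (gauge E z x) = gauge E z (h x) :=
  IsIntegral.map_gauge (f := (h : CStar E →⋆ₐ[ℂ] CStar E)) hf z x

end IsIntegral

/-- The automorphisms that, together with their inverses, preserve the sums of words. -/
def integralAut (hs : E.NoSinks) : Subgroup (CStar E ≃⋆ₐ[ℂ] CStar E) where
  carrier := {h | IsIntegral (E := E) h ∧ IsIntegral (E := E) (h⁻¹ : CStar E ≃⋆ₐ[ℂ] CStar E)}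
  mul_mem' {g h} hg hh := by
    refine ⟨⟨fun e => hg.1.map_mem hs (hh.1.1 e), fun x => hg.1.map_mem hs (hh.1.2 x)⟩, ?_⟩
    rw [mul_inv_rev]
    exact ⟨fun e => hh.2.map_mem hs (hg.2.1 e), fun x => hh.2.map_mem hs (hg.2.2 x)⟩
  one_mem' := by
    rw [Set.mem_ofPred_eq, inv_one, and_self]
    exact ⟨fun e => S_mem_wordSpan e, fun x => P_mem_wordSpan hs x⟩
  inv_mem' {h} hh := ⟨hh.2, by rw [inv_inv]; exact hh.1⟩

theorem mem_core_of_mem_wordSpan {x : CStar E} (hx : x ∈ wordSpan E ℕ 0) : x ∈ core E :=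
  fun z => by rw [gauge_eq_smul z (natSpan_le _ hx), zpow_zero, one_smul]

theorem initProj_mem_wordSpan (hs : E.NoSinks) {a b : List W} (ha : a ≠ []) (hb : b ≠ []) :
    initProj E a b ∈ wordSpan E ℕ 0 := by
  rcases initProj_eq' (E := E) ha hb with h | ⟨x, h⟩ <;> rw [h]
  · exact Submodule.zero_mem _
  · exact P_mem_wordSpan hs x

/-- Integrality for `S_a⋆ S_a S_b⋆ S_b`. -/
theorem exists_eq_nsmul_initProj (hs : E.NoSinks) {x : CStar E} (hx : x ∈ wordSpan E ℕ 0)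
    {a b : List W} (ha : a ≠ []) (hb : b ≠ []) (c : ℂ)
    (h : ‖x - c • initProj E a b‖ < 1 / 4) : ∃ n : ℕ, x = n • initProj E a b := by
  rcases initProj_eq' (E := E) ha hb with h0 | ⟨v, hv⟩
  · rw [h0, smul_zero] at h
    refine ⟨0, ?_⟩
    rw [zero_smul]
    exact eq_of_norm_sub_lt hs hx (Submodule.zero_mem _) (h.trans (by norm_num))
  · rw [hv] at h ⊢
    exact exists_eq_nsmul_P hs hx v c h

/-- An integral automorphism that fixes the vertex projections reflects sums of words of degree
`0`. -/
theorem IsIntegral.mem_of_map_mem (hs : E.NoSinks) {h : CStar E ≃⋆ₐ[ℂ] CStar E}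
    (hh : IsIntegral (E := E) h) (hP : ∀ x, h (P E x) = P E x) {v : CStar E} (hv : v ∈ core E)
    (hhv : h v ∈ wordSpan E ℕ 0) : v ∈ wordSpan E ℕ 0 := by
  obtain ⟨y, hy, hvy⟩ := exists_norm_sub_lt_of_mem_core hs hv (ε := 1 / 4) (by norm_num)
  obtain ⟨N, hN⟩ := compress_mem hs hy
  rw [eq_sum_compress hs (N + 1) (N + 1) v]
  refine Submodule.sum_mem _ fun a ha => Submodule.sum_mem _ fun b hb => ?_
  rw [mem_listsOfLength] at ha hb
  have ha' : a ≠ [] := ne_nil_of_le_length (k := 0) (by omega)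
  have hb' : b ≠ [] := ne_nil_of_le_length (k := 0) (by omega)
  obtain ⟨c, hc⟩ := hN a b (by omega) (by omega) (by omega)
  have h1 : h (star (word E a) * v * word E b) ∈ wordSpan E ℕ 0 := by
    rw [map_mul, map_mul, map_star]
    have := mul_mem_wordSpan hs (mul_mem_wordSpan hs (star_mem_wordSpan
      (hh.map_word_mem hs a)) hhv) (hh.map_word_mem hs b)
    rwa [ha, hb, add_zero, neg_add_cancel] at this
  -- As h fixes the vertex projections, the image of the compression stays close to c times the same
  -- projection. Being a natural sum, the image is a natural multiple of it, and injectivity of h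
  -- brings this back to v.
  have h2 : h (initProj E a b) = initProj E a b := by
    rcases initProj_eq' (E := E) ha' hb' with h | ⟨x, h⟩ <;> rw [h]
    · exact map_zero _
    · exact hP x
  have h3 : ‖h (star (word E a) * v * word E b) - c • initProj E a b‖ < 1 / 4 := by
    have e1 : h (star (word E a) * v * word E b) - c • initProj E a b =
        h (star (word E a) * (v - y) * word E b) := by
      rw [mul_sub, sub_mul, hc, map_sub, map_smul, h2]
    rw [e1]
    exact ((NonUnitalStarAlgHom.norm_apply_le h _).trans
      (norm_star_word_mul_mul_le a b _)).trans_lt hvy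
  obtain ⟨n, hn⟩ := exists_eq_nsmul_initProj hs h1 ha' hb' c h3
  have h4 : star (word E a) * v * word E b = n • initProj E a b := by
    apply EquivLike.injective h
    rw [hn, map_nsmul, h2]
  rw [h4]
  have := mul_mem_wordSpan hs (mul_mem_wordSpan hs (word_mem_natSpan a)
    (nsmul_mem (initProj_mem_wordSpan hs ha' hb') n)) (star_mem_wordSpan (word_mem_natSpan b))
  rwa [ha, hb, add_zero, add_neg_cancel] at this

/-! ### The generators of the group are integral -/

theorem pathS_mem_wordSpan (hs : E.NoSinks) {k : ℕ} (μ : E.Path k) :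
    pathS μ ∈ wordSpan E ℕ k := by
  have h1 : pathS μ = P E μ.source * word E μ.edges := rfl
  have := mul_mem_wordSpan hs (P_mem_wordSpan hs μ.source) (word_mem_natSpan (E := E) μ.edges)
  rwa [← h1, zero_add, μ.length_edges] at this

theorem permUnitary_mem_wordSpan (hs : E.NoSinks) {w : unitary (CStar E)}
    (hw : w ∈ permUnitary E) : (w : CStar E) ∈ wordSpan E ℕ 0 := by
  obtain ⟨k, Λ, h⟩ := hw
  rw [h]
  refine Submodule.sum_mem _ fun q _ => ?_
  have := mul_mem_wordSpan hs (pathS_mem_wordSpan hs q.1)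
    (star_mem_wordSpan (pathS_mem_wordSpan hs q.2))
  rwa [add_neg_cancel] at this

/-- For h = λ_u integrality is clear. Its inverse sends S_e to v S_e, where h(v) = u⋆. Since h
commutes with the gauge action, v lies in the core, and `IsIntegral.mem_of_map_mem` shows that v has
natural coefficients because u⋆ does. -/
theorem lambdaPerm_subset (hs : E.NoSinks) : lambdaPerm E ⊆ integralAut hs := by
  rintro h ⟨u, hu, hlam⟩
  have hP : ∀ x, h (P E x) = P E x := fun x => (hlam _).trans (lift_P _ x)
  have hS : ∀ e, h (S E e) = ((u : unitary (CStar E)) : CStar E) * S E e :=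
    fun e => (hlam _).trans (lift_S _ e)
  have hu0 := permUnitary_mem_wordSpan hs hu
  have hint : IsIntegral (E := E) h := by
    refine ⟨fun e => ?_, fun x => ?_⟩
    · rw [hS, ← zero_add (1 : ℤ)]
      exact mul_mem_wordSpan hs hu0 (S_mem_wordSpan e)
    · rw [hP]; exact P_mem_wordSpan hs x
  have hus : star ((u : unitary (CStar E)) : CStar E) ∈ wordSpan E ℕ 0 := by
    have := star_mem_wordSpan hu0
    rwa [neg_zero] at this
  have hinv : ∀ x, h ((h⁻¹ : CStar E ≃⋆ₐ[ℂ] CStar E) x) = x := fun x => h.apply_symm_apply x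
  have hinv' : ∀ x, (h⁻¹ : CStar E ≃⋆ₐ[ℂ] CStar E) (h x) = x := fun x => h.symm_apply_apply x
  obtain ⟨v, hv⟩ : ∃ v, h v = star ((u : unitary (CStar E)) : CStar E) := ⟨_, hinv _⟩
  have hvcore : v ∈ core E := fun z => by
    apply EquivLike.injective h
    rw [hint.equiv_map_gauge, hv]
    exact mem_core_of_mem_wordSpan hus z
  have hv0 : v ∈ wordSpan E ℕ 0 := hint.mem_of_map_mem hs hP hvcore (by rw [hv]; exact hus)
  refine ⟨hint, fun e => ?_, fun x => ?_⟩
  · have h1 : (h⁻¹ : CStar E ≃⋆ₐ[ℂ] CStar E) (S E e) = v * S E e := by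
      apply EquivLike.injective h
      rw [hinv, map_mul, hv, hS, ← mul_assoc, Unitary.coe_star_mul_self, one_mul]
    rw [h1, ← zero_add (1 : ℤ)]
    exact mul_mem_wordSpan hs hv0 (S_mem_wordSpan e)
  · rw [← hP x, hinv']; exact P_mem_wordSpan hs x

theorem graphAut_subset (hs : E.NoSinks) : graphAut E ⊆ integralAut hs := by
  rintro h ⟨σ, hS, hP⟩
  have hinv' : ∀ x, (h⁻¹ : CStar E ≃⋆ₐ[ℂ] CStar E) (h x) = x := fun x => h.symm_apply_apply x
  refine ⟨⟨fun e => ?_, fun x => ?_⟩, fun e => ?_, fun x => ?_⟩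
  · rw [hS]; exact S_mem_wordSpan _
  · rw [hP]; exact P_mem_wordSpan hs _
  · obtain ⟨e, rfl⟩ := σ.onW.surjective e
    rw [← hS, hinv']; exact S_mem_wordSpan _
  · obtain ⟨x, rfl⟩ := σ.onV.surjective x
    rw [← hP, hinv']; exact P_mem_wordSpan hs _

theorem groupGR_le (hs : E.NoSinks) : groupGR E ≤ integralAut hs :=
  (Subgroup.closure_le _).2 (Set.union_subset (lambdaPerm_subset hs) (graphAut_subset hs))

end CStar

end DirectedGraph

namespace DirectedGraph

universe u v

variable {V : Type u} {W : Type v}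

/-! ### Counting paths -/

theorem isWalk_iterate (E : DirectedGraph V W) (ψ : W → W) (hψ : ∀ e, E.s (ψ e) = E.r e) (e : W)
    (n : ℕ) : E.IsWalk (E.s e) (List.iterate ψ e n) (E.s (ψ^[n] e)) := by
  induction n generalizing e with
  | zero => rfl
  | succ n ih =>
    refine ⟨rfl, ?_⟩
    rw [← hψ]
    exact ih (ψ e)

/-- In a nonempty finite graph without sinks whose loops have exits, some vertex emits two
edges. -/
theorem exists_ne_source_eq [Nonempty V] [Finite W] (E : DirectedGraph V W) (hs : E.NoSinks)
    (hexit : E.EveryLoopHasExit) : ∃ e f : W, e ≠ f ∧ E.s e = E.s f := by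
  by_contra! hinj
  -- `ψ` picks an edge that follows a given one. By finiteness an orbit of `ψ` revisits an edge; the
  -- loop so obtained has an exit, against the injectivity of the source map.
  choose ψ hψ using fun e => hs (E.r e)
  obtain ⟨e₀, -⟩ := hs (Classical.arbitrary V)
  obtain ⟨m, n, hmn, h⟩ := Finite.exists_ne_map_eq_of_infinite fun n : ℕ => ψ^[n] e₀
  wlog hlt : m < n generalizing m n
  · exact this n m hmn.symm h.symm (by omega)
  have hper : ψ^[n - m] (ψ^[m] e₀) = ψ^[m] e₀ := by
    rw [← Function.iterate_add_apply, Nat.sub_add_cancel hlt.le]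
    exact h.symm
  obtain ⟨e, -, f, g, hfg, h1, h2⟩ := hexit (n - m)
    ⟨E.s (ψ^[m] e₀), List.iterate ψ (ψ^[m] e₀) (n - m), _, by simp,
      E.isWalk_iterate ψ hψ (ψ^[m] e₀) (n - m)⟩ (by omega)
    (congrArg E.s hper.symm)
  exact hinj f g hfg (h1.trans h2.symm)

variable [Fintype V] [Fintype W]

namespace CStar

variable {E : DirectedGraph V W}

open Classical in
/-- The lists of `k` edges that form a path, as those whose word does not vanish. -/
noncomputable def admissible (E : DirectedGraph V W) (k : ℕ) : Finset (List W) :=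
  (listsOfLength W k).filter fun l => word E l ≠ 0

theorem mem_admissible {k : ℕ} {l : List W} :
    l ∈ admissible E k ↔ l.length = k ∧ word E l ≠ 0 := by
  simp [admissible]

/-- Without sources a path ending at x can be prolonged backwards. The vertex y records where it
starts, which is where the next edge is attached. -/
theorem exists_word_eq_P (hsource : E.NoSources) (k : ℕ) (x : V) :
    ∃ l : List W, l.length = k + 1 ∧ star (word E l) * word E l = P E x ∧
      ∃ y, P E y * word E l = word E l := by
  induction k with
  | zero =>
    obtain ⟨e, rfl⟩ := hsource x
    exact ⟨[e], rfl, by rw [word_singleton, (isCKFamily E).star_mul_self], E.s e,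
      by rw [word_singleton, P_mul_S]⟩
  | succ k ih =>
    obtain ⟨l, hl, hx, y, hy⟩ := ih
    obtain ⟨e, rfl⟩ := hsource y
    refine ⟨e :: l, by simp [hl], ?_, E.s e, by rw [word_cons, ← mul_assoc, P_mul_S]⟩
    rw [word_cons, star_mul, mul_assoc, ← mul_assoc (star (S E e)), (isCKFamily E).star_mul_self,
      hy, hx]

theorem word_append_singleton_ne_zero (hs : E.NoSinks) {l : List W} {e : W}
    (h : star (word E l) * word E l = P E (E.s e)) : word E (l ++ [e]) ≠ 0 := by
  intro h0
  have h1 : star (word E (l ++ [e])) * word E (l ++ [e]) = P E (E.r e) := by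
    rw [word_append, word_singleton, star_mul, mul_assoc, ← mul_assoc (star (word E l)), h,
      P_mul_S, (isCKFamily E).star_mul_self]
  rw [h0, mul_zero] at h1
  exact P_ne_zero hs _ h1.symm

/-- Forgetting the last edge maps the longer paths onto the shorter ones, as there are no sinks. It
is not injective: a path that ends at the common source of e and f extends by either. -/
theorem card_admissible_lt (hs : E.NoSinks) (hsource : E.NoSources) {e f : W} (hef : e ≠ f)
    (hsef : E.s e = E.s f) (k : ℕ) :
    (admissible E (k + 1)).card < (admissible E (k + 2)).card := by
  classical
  have himage : (admissible E (k + 2)).image List.dropLast = admissible E (k + 1) := by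
    ext l
    simp only [Finset.mem_image, mem_admissible]
    constructor
    · rintro ⟨l, ⟨h1, h2⟩, rfl⟩
      refine ⟨by simp [h1], fun h => h2 ?_⟩
      have hne : l ≠ [] := ne_nil_of_le_length h1.ge
      rw [← List.dropLast_append_getLast hne, word_append, h, zero_mul]
    · rintro ⟨h1, h2⟩
      obtain ⟨g, hg⟩ : ∃ g, word E (l ++ [g]) ≠ 0 := by
        by_contra! h
        apply h2
        rw [← mul_one (word E l), ← sum_S_mul_star hs, Finset.mul_sum]
        refine Finset.sum_eq_zero fun g _ => ?_
        have := h g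
        rw [word_append, word_singleton] at this
        rw [← mul_assoc, this, zero_mul]
      exact ⟨l ++ [g], ⟨by simp [h1], hg⟩, by simp⟩
  rw [← himage]
  refine lt_of_le_of_ne Finset.card_image_le fun h => ?_
  have hinj := Finset.card_image_iff.1 h
  obtain ⟨l, hl, hx, -⟩ := exists_word_eq_P hsource k (E.s e)
  have h1 : l ++ [e] ∈ admissible E (k + 2) :=
    mem_admissible.2 ⟨by simp [hl], word_append_singleton_ne_zero hs hx⟩
  have h2 : l ++ [f] ∈ admissible E (k + 2) :=
    mem_admissible.2 ⟨by simp [hl], word_append_singleton_ne_zero hs (by rw [hx, hsef])⟩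
  have h3 := hinj h1 h2 (by simp)
  exact hef (by simpa using h3)

theorem admissible_card_injective (hs : E.NoSinks) (hsource : E.NoSources)
    (hexit : E.EveryLoopHasExit) [Nonempty V] {m n : ℕ}
    (h : (admissible E (m + 1)).card = (admissible E (n + 1)).card) : m = n := by
  obtain ⟨e, f, hef, hsef⟩ := E.exists_ne_source_eq hs hexit
  exact (strictMono_nat_of_lt_succ (f := fun k => (admissible E (k + 1)).card)
    (card_admissible_lt hs hsource hef hsef)).injective h

/-! ### Unitaries that implement integral automorphisms -/

/-- The error is at most (‖x‖ + ‖y‖)‖x − y‖ ≤ 2.01/100, well below the thresholds 1/4 and 1 of the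
integrality lemmas. -/
theorem norm_conj_sub_conj_lt {A : Type*} [CStarAlgebra A] {x y p : A} (hx : ‖x‖ ≤ 1)
    (hp : ‖p‖ ≤ 1) (h : ‖x - y‖ < 1 / 100) :
    ‖x * p * star x - y * p * star y‖ < 3 / 100 := by
  have hy : ‖y‖ ≤ 101 / 100 := by
    have := norm_sub_norm_le y x
    rw [norm_sub_rev] at this
    linarith
  have e : x * p * star x - y * p * star y = (x - y) * p * star x + y * p * star (x - y) := by
    rw [star_sub]; noncomm_ring
  have h1 : ‖(x - y) * p * star x‖ ≤ ‖x - y‖ := by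
    refine (norm_mul_le _ _).trans ?_
    rw [norm_star]
    refine (mul_le_of_le_one_right (norm_nonneg _) hx).trans ?_
    exact (norm_mul_le _ _).trans (mul_le_of_le_one_right (norm_nonneg _) hp)
  have h2 : ‖y * p * star (x - y)‖ ≤ 101 / 100 * ‖x - y‖ := by
    refine (norm_mul_le _ _).trans ?_
    rw [norm_star]
    refine mul_le_mul_of_nonneg_right ?_ (norm_nonneg _)
    exact ((norm_mul_le _ _).trans (mul_le_of_le_one_right (norm_nonneg _) hp)).trans hy
  rw [e]
  refine (norm_add_le _ _).trans_lt ?_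
  linarith

theorem star_initProj (a b : List W) : star (initProj E a b) = initProj E b a := by
  simp [initProj]

/-- A unitary of `C⋆(E)` that implements an integral automorphism. -/
structure Implements (w : CStar E) (h : CStar E ≃⋆ₐ[ℂ] CStar E) : Prop where
  star_mul_cancel : star w * w = 1
  mul_star_cancel : w * star w = 1
  apply_eq : ∀ x, h x = w * x * star w
  integral : IsIntegral (E := E) h

variable {w : CStar E} {h : CStar E ≃⋆ₐ[ℂ] CStar E}

/-- The unitary w need not be a sum of words itself. Integrality is available only for expressions w
(·) w⋆ = h(·), and all information about w is drawn from these. -/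
theorem Implements.conj_mem (hs : E.NoSinks) (H : Implements w h) {a b c d : List W}
    (hab : a.length = c.length) (hbd : b.length = d.length) :
    star (word E a) * (w * (word E b * star (word E d)) * star w) * word E c ∈
      wordSpan E ℕ 0 := by
  rw [← H.apply_eq]
  have h1 := H.integral.map_mem hs (word_mem_wordSpan b d (d := 0) (by omega))
  have := mul_mem_wordSpan hs (mul_mem_wordSpan hs (star_mem_wordSpan (word_mem_natSpan a)) h1)
    (word_mem_natSpan c)
  rwa [hab, add_zero, neg_add_cancel] at this

theorem Implements.norm_le (H : Implements w h) : ‖w‖ ≤ 1 := by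
  have h1 : ‖w‖ * ‖w‖ ≤ 1 := by
    rw [← CStarRing.norm_star_mul_self, H.star_mul_cancel]
    exact (IsStarProjection.one (CStar E)).norm_le _
  by_contra h
  nlinarith

/-- For the compression x, the natural sum x x⋆ is close to |c|² P_v, hence is n P_v with n natural;
‖x‖ ≤ 1 leaves n = 0 or n = 1. -/
theorem Implements.compress_eq_zero_or (hs : E.NoSinks) (H : Implements w h) {a b : List W}
    (ha : a ≠ []) (hb : b ≠ []) {c : ℂ}
    (hc : ‖star (word E a) * w * word E b - c • initProj E a b‖ < 1 / 100) :
    star (word E a) * w * word E b = 0 ∨ ∃ v, star (word E a) * word E a = P E v ∧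
      star (word E b) * word E b = P E v ∧
      star (word E a) * w * word E b * star (star (word E a) * w * word E b) = P E v := by
  set x := star (word E a) * w * word E b with hx
  have hx1 : ‖x‖ ≤ 1 := (norm_star_word_mul_mul_le a b w).trans H.norm_le
  have hxx : x * star x ∈ wordSpan E ℕ 0 := by
    have := H.conj_mem hs (a := a) (c := a) (b := b) (d := b) rfl rfl
    convert this using 1
    rw [hx, star_mul, star_mul, star_star]; noncomm_ring
  have hxx1 : ‖x * star x‖ ≤ 1 := by
    rw [CStarRing.norm_self_mul_star]
    exact mul_le_one₀ hx1 (norm_nonneg _) hx1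
  have h1 := norm_conj_sub_conj_lt hx1 ((IsStarProjection.one (CStar E)).norm_le _) hc
  rw [mul_one, mul_one] at h1
  have zero_of : x * star x = 0 → x = 0 := fun h => CStarRing.mul_star_self_eq_zero_iff x |>.1 h
  rcases initProj_eq (E := E) ha hb with h0 | ⟨v, hav, hbv, hv⟩
  · left
    apply zero_of
    apply eq_of_norm_sub_lt hs hxx (Submodule.zero_mem _)
    rw [h0] at h1
    simp only [smul_zero, mul_zero, star_zero] at h1
    linarith
  · rw [hv] at h1
    have h2 : c • P E v * star (c • P E v) = (c * star c) • P E v := by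
      rw [star_smul, star_P, smul_mul_smul_comm, P_mul_P]
    rw [h2] at h1
    obtain ⟨n, hn⟩ := exists_eq_nsmul_P hs hxx v _ (h1.trans (by norm_num))
    have h3 : n ≤ 1 := by
      rw [hn, ← Nat.cast_smul_eq_nsmul ℂ, norm_smul, Complex.norm_natCast] at hxx1
      have h4 := one_le_norm_P hs v
      have : (n : ℝ) ≤ 1 := by nlinarith [n.cast_nonneg (α := ℝ)]
      exact_mod_cast this
    interval_cases n
    · left; exact zero_of (by rw [hn, zero_smul])
    · right; exact ⟨v, hav, hbv, by rw [hn, one_smul]⟩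

/-- If the compression of `w` at `(a, b)` is an isometry of the corner, then `S_a⋆ w` has no other
coefficients. -/
theorem star_word_mul_eq (hw : w * star w = 1) {a b : List W} {v : V}
    (ha : star (word E a) * word E a = P E v) (hb : star (word E b) * word E b = P E v)
    (hx : star (word E a) * w * word E b * star (star (word E a) * w * word E b) = P E v) :
    star (word E a) * w = star (word E a) * w * word E b * star (word E b) := by
  set x := star (word E a) * w * word E b with hxdef
  have h1 : x * P E v = x := by rw [hxdef, mul_assoc, word_mul_P hb]
  have h2 : (star (word E a) * w - x * star (word E b)) *
      star (star (word E a) * w - x * star (word E b)) = 0 := by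
    have e1 : star (word E a) * w * star (star (word E a) * w) = P E v := by
      rw [star_mul, star_star, mul_assoc, ← mul_assoc w, hw, one_mul, ha]
    have e2 : star (word E a) * w * star (x * star (word E b)) = P E v := by
      rw [star_mul, star_star, ← mul_assoc, ← hxdef, hx]
    have e3 : x * star (word E b) * star (star (word E a) * w) = P E v := by
      have := congrArg star e2
      rwa [star_mul, star_star, star_P] at this
    have e4 : x * star (word E b) * star (x * star (word E b)) = P E v := by
      rw [star_mul, star_star, mul_assoc, ← mul_assoc (star (word E b)), hb, ← mul_assoc, h1, hx]
    rw [star_sub, sub_mul, mul_sub, mul_sub, e1, e2, e3, e4, sub_self]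
  exact sub_eq_zero.1 (CStarRing.mul_star_self_eq_zero_iff _ |>.1 h2)

/-- The matching of paths given by the large coefficients of `w`. -/
structure Matched (w : CStar E) (a b : List W) (v : V) (c : ℂ) : Prop where
  init_left : star (word E a) * word E a = P E v
  init_right : star (word E b) * word E b = P E v
  norm_sub_lt : ‖star (word E a) * w * word E b - c • P E v‖ < 1 / 100
  mul_star : star (word E a) * w * word E b * star (star (word E a) * w * word E b) = P E v
  star_mul_word : star (word E a) * w = star (word E a) * w * word E b * star (word E b)
  mul_word : w * word E b = word E a * (star (word E a) * w * word E b)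

/-- Applying the dichotomy to w⋆ as well as to w shows that a nonzero coefficient is the only one in
its column as well as in its row. -/
theorem Implements.matched (hs : E.NoSinks) (H : Implements w h)
    (H' : Implements (star w) h.symm) {a b : List W}
    (ha : a ≠ []) (hb : b ≠ []) {c : ℂ}
    (hc : ‖star (word E a) * w * word E b - c • initProj E a b‖ < 1 / 100)
    (h0 : star (word E a) * w * word E b ≠ 0) : ∃ v, Matched w a b v c := by
  rcases H.compress_eq_zero_or hs ha hb hc with h | ⟨v, hav, hbv, hx⟩
  · exact absurd h h0
  have hstar : star (star (word E a) * w * word E b) = star (word E b) * star w * word E a := by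
    rw [star_mul, star_mul, star_star, mul_assoc]
  have hc' : ‖star (word E b) * star w * word E a - star c • initProj E b a‖ < 1 / 100 := by
    rw [← hstar, ← star_initProj, ← star_smul, ← star_sub, norm_star]
    exact hc
  rcases H'.compress_eq_zero_or hs hb ha hc' with h | ⟨v', hbv', hav', hx'⟩
  · rw [← hstar, star_eq_zero] at h; exact absurd h h0
  have h1 := star_word_mul_eq H'.mul_star_cancel hbv' hav' hx'
  have h2 := congrArg star h1
  simp only [star_mul, star_star] at h2
  refine ⟨v, hav, hbv, ?_, hx, star_word_mul_eq H.mul_star_cancel hav hbv hx, ?_⟩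
  · rw [initProj, hav, hbv, P_mul_P] at hc; exact hc
  · rw [h2]; simp only [mul_assoc]

/-- Every row and every column of the coefficient matrix of w has a nonzero entry because w is
unitary, and only one by `Implements.matched`. This is a bijection between the paths of two lengths
that differ by d. -/
theorem Implements.exists_matching (hs : E.NoSinks) (hsource : E.NoSources)
    (hexit : E.EveryLoopHasExit) [Nonempty V] (H : Implements w h)
    (H' : Implements (star w) h.symm) {d : ℤ} {y : CStar E} (hy : y ∈ wordSpan E ℂ d)
    (hwy : ‖w - y‖ < 1 / 100) :
    ∃ (n : ℕ) (π : Equiv.Perm {l // l ∈ admissible E n}),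
      ∀ b, ∃ v c, Matched w (π b : List W) b v c := by
  obtain ⟨N, hN⟩ := compress_mem hs hy
  -- Adding `d.natAbs` keeps both lengths at least N even for negative d; the `+ 1` makes the words
  -- nonempty.
  obtain ⟨n, m, hn, hm, hmn⟩ : ∃ n m : ℕ, N ≤ n ∧ N ≤ m ∧ ((m + 1 : ℕ) : ℤ) - (n + 1 : ℕ) = d :=
    ⟨N + d.natAbs, (N + d.natAbs + d).toNat, by omega, by omega, by omega⟩
  have hcoef : ∀ a b : List W, a.length = m + 1 → b.length = n + 1 →
      ∃ c : ℂ, ‖star (word E a) * w * word E b - c • initProj E a b‖ < 1 / 100 := by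
    intro a b ha hb
    obtain ⟨c, hc⟩ := hN a b (by omega) (by omega) (by omega)
    refine ⟨c, ?_⟩
    rw [← hc, ← sub_mul, ← mul_sub]
    exact (norm_star_word_mul_mul_le a b _).trans_lt hwy
  have hmatch : ∀ a b : List W, a.length = m + 1 → b.length = n + 1 →
      star (word E a) * w * word E b ≠ 0 → ∃ v c, Matched w a b v c := by
    intro a b ha hb h0
    obtain ⟨c, hc⟩ := hcoef a b ha hb
    obtain ⟨v, hv⟩ := H.matched hs H' (ne_nil_of_le_length ha.ge) (ne_nil_of_le_length hb.ge) hc h0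
    exact ⟨v, c, hv⟩
  have adm_left : ∀ a b : List W, star (word E a) * w * word E b ≠ 0 → word E a ≠ 0 := by
    intro a b h h'
    rw [h'] at h; simp at h
  have adm_right : ∀ a b : List W, star (word E a) * w * word E b ≠ 0 → word E b ≠ 0 := by
    intro a b h h'
    rw [h'] at h; simp at h
  have exA : ∀ b : List W, b ∈ admissible E (n + 1) → ∃ a ∈ admissible E (m + 1),
      star (word E a) * w * word E b ≠ 0 := by
    intro b hb
    rw [mem_admissible] at hb
    by_contra! hcon
    apply hb.2
    have h1 : w * word E b = 0 := by
      rw [← one_mul (w * word E b), ← sum_word_mul_star hs (m + 1), Finset.sum_mul]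
      refine Finset.sum_eq_zero fun a ha => ?_
      rw [mul_assoc, ← mul_assoc (star (word E a))]
      by_cases h0 : word E a = 0
      · rw [h0, zero_mul]
      · rw [hcon a (mem_admissible.2 ⟨mem_listsOfLength.1 ha, h0⟩), mul_zero]
    rw [← one_mul (word E b), ← H.star_mul_cancel, mul_assoc, h1, mul_zero]
  have exB : ∀ a : List W, a ∈ admissible E (m + 1) → ∃ b ∈ admissible E (n + 1),
      star (word E a) * w * word E b ≠ 0 := by
    intro a ha
    rw [mem_admissible] at ha
    by_contra! hcon
    apply ha.2
    have h1 : star (word E a) * w = 0 := by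
      rw [← mul_one (star (word E a) * w), ← sum_word_mul_star hs (n + 1), Finset.mul_sum]
      refine Finset.sum_eq_zero fun b hb => ?_
      rw [← mul_assoc]
      by_cases h0 : word E b = 0
      · rw [h0, star_zero, mul_zero]
      · rw [hcon b (mem_admissible.2 ⟨mem_listsOfLength.1 hb, h0⟩), zero_mul]
    rw [← star_eq_zero, ← mul_one (star (word E a)), ← H.mul_star_cancel, ← mul_assoc, h1, zero_mul]
  have uniqB : ∀ a b b' : List W, a.length = m + 1 → b.length = n + 1 → b'.length = n + 1 →
      star (word E a) * w * word E b ≠ 0 → star (word E a) * w * word E b' ≠ 0 → b = b' := by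
    intro a b b' ha hb hb' h1 h2
    by_contra hne
    obtain ⟨v, c, hM⟩ := hmatch a b ha hb h1
    apply h2
    rw [hM.star_mul_word, mul_assoc, star_word_mul_word (by omega) hne, mul_zero]
  have uniqA : ∀ a a' b : List W, a.length = m + 1 → a'.length = m + 1 → b.length = n + 1 →
      star (word E a) * w * word E b ≠ 0 → star (word E a') * w * word E b ≠ 0 → a = a' := by
    intro a a' b ha ha' hb h1 h2
    by_contra hne
    obtain ⟨v, c, hM⟩ := hmatch a b ha hb h1
    apply h2
    rw [mul_assoc, hM.mul_word, ← mul_assoc, star_word_mul_word (by omega) (Ne.symm hne), zero_mul]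
  choose φ hφ1 hφ2 using fun b : {l // l ∈ admissible E (n + 1)} => exA b.1 b.2
  have len : ∀ {k} (l : {l // l ∈ admissible E k}), l.1.length = k :=
    fun l => (mem_admissible.1 l.2).1
  let F : {l // l ∈ admissible E (n + 1)} → {l // l ∈ admissible E (m + 1)} :=
    fun b => ⟨φ b, hφ1 b⟩
  have hF : Function.Bijective F := by
    constructor
    · intro b b' hbb
      have h1 : φ b = φ b' := congrArg Subtype.val hbb
      have h2 := hφ2 b'
      rw [← h1] at h2
      exact Subtype.ext (uniqB (φ b) b b' (len (F b)) (len b) (len b') (hφ2 b) h2)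
    · intro a
      obtain ⟨b, hb, hab⟩ := exB a a.2
      exact ⟨⟨b, hb⟩, Subtype.ext (uniqA _ _ b (len (F ⟨b, hb⟩)) (len a) (len ⟨b, hb⟩)
        (hφ2 ⟨b, hb⟩) hab)⟩
  have hcard : (admissible E (n + 1)).card = (admissible E (m + 1)).card := by
    have := Fintype.card_of_bijective hF
    simpa using this
  -- Equal numbers of paths force equal lengths: the degree of w is 0 and the bijection is a
  -- permutation.
  obtain rfl := admissible_card_injective hs hsource hexit hcard
  exact ⟨n + 1, Equiv.ofBijective F hF, fun b => hmatch _ _ (len (F b)) (len b) (hφ2 b)⟩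

theorem ext_of_mul_word (hs : E.NoSinks) (n : ℕ) {x y : CStar E}
    (h : ∀ l : List W, l ∈ admissible E n → x * word E l = y * word E l) : x = y := by
  rw [← mul_one x, ← mul_one y, ← sum_word_mul_star hs n, Finset.mul_sum, Finset.mul_sum]
  refine Finset.sum_congr rfl fun l hl => ?_
  rw [← mul_assoc, ← mul_assoc]
  by_cases h0 : word E l = 0
  · rw [h0, mul_zero, mul_zero]
  · rw [h l (mem_admissible.2 ⟨mem_listsOfLength.1 hl, h0⟩)]

/-! ### Permutation unitaries -/

/-- The sum of the words `S_{π(b)} S_b⋆` for a permutation `π` of the paths of length `n`. -/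
noncomputable def permElem {n : ℕ} (π : Equiv.Perm {l // l ∈ admissible E n}) : CStar E :=
  ∑ b, word E (π b : List W) * star (word E (b : List W))

/-- The permutation preserves the ranges of the paths. -/
def PreservesRange {n : ℕ} (π : Equiv.Perm {l // l ∈ admissible E n}) : Prop :=
  ∀ b, ∃ v, star (word E (π b : List W)) * word E (π b : List W) = P E v ∧
    star (word E (b : List W)) * word E (b : List W) = P E v

section PermElem

variable {n : ℕ} {π : Equiv.Perm {l // l ∈ admissible E n}}

theorem length_of_admissible (b : {l // l ∈ admissible E n}) : b.1.length = n :=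
  (mem_admissible.1 b.2).1

theorem permElem_mul_word (hπ : PreservesRange π) (b : {l // l ∈ admissible E n}) :
    permElem π * word E (b : List W) = word E (π b : List W) := by
  rw [permElem, Finset.sum_mul, Finset.sum_eq_single b]
  · obtain ⟨v, h1, h2⟩ := hπ b
    rw [mul_assoc, h2, word_mul_P h1]
  · intro c _ hcb
    rw [mul_assoc, star_word_mul_word (by rw [length_of_admissible, length_of_admissible])
      (fun h => hcb (Subtype.ext h)), mul_zero]
  · simp

theorem star_permElem : star (permElem π) = permElem (E := E) π⁻¹ := by
  rw [permElem, star_sum, permElem,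
    ← Equiv.sum_comp π fun b => word E (π⁻¹ b : List W) * star (word E (b : List W))]
  refine Finset.sum_congr rfl fun b _ => ?_
  rw [star_mul, star_star, show π⁻¹ (π b) = b from π.symm_apply_apply b]

theorem PreservesRange.inv (hπ : PreservesRange π) : PreservesRange (E := E) π⁻¹ := by
  intro b
  obtain ⟨v, h1, h2⟩ := hπ (π⁻¹ b)
  rw [show π (π⁻¹ b) = b from π.apply_symm_apply b] at h1
  exact ⟨v, h2, h1⟩

theorem star_permElem_mul_word (hπ : PreservesRange π) (b : {l // l ∈ admissible E n}) :
    star (permElem π) * word E (π b : List W) = word E (b : List W) := by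
  rw [star_permElem, permElem_mul_word hπ.inv, show π⁻¹ (π b) = b from π.symm_apply_apply b]

theorem permElem_mem_unitary (hs : E.NoSinks) (hπ : PreservesRange π) :
    permElem π ∈ unitary (CStar E) := by
  constructor
  · refine ext_of_mul_word hs n fun l hl => ?_
    rw [mul_assoc, permElem_mul_word hπ ⟨l, hl⟩, star_permElem_mul_word hπ, one_mul]
  · refine ext_of_mul_word hs n fun l hl => ?_
    obtain ⟨b, hb⟩ := π.surjective ⟨l, hl⟩
    have hb' : (π b : List W) = l := congrArg Subtype.val hb
    rw [← hb', mul_assoc, star_permElem_mul_word hπ, permElem_mul_word hπ, one_mul]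

theorem permElem_mem_wordSpan : permElem (E := E) π ∈ wordSpan E ℕ 0 :=
  Submodule.sum_mem _ fun b _ => word_mem_wordSpan _ _
    (by rw [length_of_admissible, length_of_admissible, sub_self])

theorem permElem_pow_mul_word (hπ : PreservesRange π) (k : ℕ) (b : {l // l ∈ admissible E n}) :
    permElem π ^ k * word E (b : List W) = word E ((π ^ k) b : List W) := by
  induction k with
  | zero => simp
  | succ k ih =>
    rw [pow_succ', mul_assoc, ih, permElem_mul_word hπ, pow_succ', Equiv.Perm.mul_apply]

/-- The unitary permutes the words S_b as π permutes the paths, so the order of π serves as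
exponent. -/
theorem exists_permElem_pow_eq_one (hs : E.NoSinks) (hπ : PreservesRange π) :
    ∃ k, 0 < k ∧ permElem π ^ k = 1 := by
  refine ⟨orderOf π, orderOf_pos π, ext_of_mul_word hs n fun l hl => ?_⟩
  rw [permElem_pow_mul_word hπ _ ⟨l, hl⟩, pow_orderOf_eq_one, one_mul]
  rfl

end PermElem

/-! ### Diagonal unitaries -/

/-- A diagonal sum of words of degree `0` whose square is a diagonal projection is equal to it. -/
theorem eq_of_diagonal (hs : E.NoSinks) {b f : CStar E} (hb : b ∈ wordSpan E ℕ 0) {K : ℕ}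
    (hq : ∀ l : List W, K ≤ l.length → Commute b (word E l * star (word E l)))
    (hbb : b * star b = f)
    (hf : ∀ l : List W, l ≠ [] → f * word E l = word E l ∨ f * word E l = 0) : b = f := by
  obtain ⟨N, hN⟩ := compress_mem hs hb
  refine ext_of_mul_word hs (N + K + 1) fun a ha => ?_
  obtain ⟨ha, ha0⟩ := mem_admissible.1 ha
  have hane : a ≠ [] := ne_nil_of_le_length (k := 0) (by omega)
  obtain ⟨v, hv⟩ := (star_word_mul_self (E := E) hane).resolve_left ha0
  have hQ : initProj E a a = P E v := by rw [initProj, hv, P_mul_P]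
  have hwv : word E a * P E v = word E a := word_mul_P hv
  obtain ⟨m, hm⟩ := hN a a (by omega) (by omega) (by omega)
  rw [hQ] at hm
  have hm' : star (word E a) * star b * word E a = m • P E v := by
    have := congrArg star hm
    rw [star_nsmul, star_P] at this
    rw [← this, star_mul, star_mul, star_star, mul_assoc]
  have key : ∀ x : CStar E, Commute x (word E a * star (word E a)) →
      star (word E a) * x * word E a = m • P E v → x * word E a = m • word E a := by
    intro x hx hxm
    calc x * word E a = x * (word E a * star (word E a)) * word E a := by
          rw [mul_assoc, mul_assoc, hv, hwv]
      _ = word E a * (star (word E a) * x * word E a) := by rw [hx.eq]; simp only [mul_assoc]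
      _ = m • word E a := by rw [hxm, mul_smul_comm, hwv]
  have hq1 := hq a (by omega)
  have hq2 : Commute (star b) (word E a * star (word E a)) := by
    have := hq1.star_star
    rwa [star_mul, star_star] at this
  have h1 := key b hq1 hm
  have h2 := key (star b) hq2 hm'
  -- On S_a, b acts as m and b b⋆ = f acts as m². Natural rather than integral coefficients are
  -- essential: m² = 1 must exclude m = −1.
  have h3 : f * word E a = (m * m) • word E a := by
    rw [← hbb, mul_assoc, h2, mul_smul_comm, h1, smul_smul]
  rcases hf a hane with h4 | h4
  · have h5 : (((m * m : ℕ) : ℂ) - 1) • word E a = 0 := by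
      rw [sub_smul, one_smul, Nat.cast_smul_eq_nsmul, ← h3, h4, sub_self]
    have h6 : ((m * m : ℕ) : ℂ) = 1 := sub_eq_zero.1 ((smul_eq_zero.1 h5).resolve_right ha0)
    have h7 : m * m = 1 := by exact_mod_cast h6
    rw [h1, h4, Nat.eq_one_of_mul_eq_one_left h7, one_smul]
  · have h5 : ((m * m : ℕ) : ℂ) • word E a = 0 := by
      rw [Nat.cast_smul_eq_nsmul, ← h3, h4]
    have h6 : ((m * m : ℕ) : ℂ) = 0 := (smul_eq_zero.1 h5).resolve_right ha0
    have h7 : m * m = 0 := by exact_mod_cast h6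
    rw [h1, h4, mul_self_eq_zero.1 h7, zero_smul]

/-- A unitary that commutes with the range projections of all long words and that implements an
integral automorphism commutes with the generators. -/
theorem conj_S_eq_of_commute (hs : E.NoSinks) {d : CStar E} (hd1 : star d * d = 1)
    (hd2 : d * star d = 1) {n : ℕ}
    (hcomm : ∀ l : List W, n ≤ l.length → Commute d (word E l * star (word E l)))
    (hmem : ∀ e, d * S E e * star d ∈ wordSpan E ℕ 1) (e : W) :
    d * S E e * star d = S E e := by
  classical
  have hqstar : ∀ l : List W, star (word E l * star (word E l)) = word E l * star (word E l) :=
    fun l => by rw [star_mul, star_star]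
  have hcomm' : ∀ l : List W, n ≤ l.length → Commute (star d) (word E l * star (word E l)) :=
    fun l hl => by
      have := (hcomm l hl).star_star
      rwa [hqstar] at this
  -- S_e S_e⋆ is a sum of range projections of words of length n + 1, to which the hypothesis
  -- applies; likewise for P_x.
  have hde : Commute d (S E e * star (S E e)) := by
    have := word_mul_star_word hs [e] [e] n
    rw [word_singleton] at this
    rw [this]
    exact Commute.sum_right _ _ _ fun l hl => hcomm _ (by simp [mem_listsOfLength.1 hl])
  have hdP : ∀ x, Commute d (P E x) := fun x => by
    rw [P_eq_sum hs]
    refine Commute.sum_right _ _ _ fun f _ => ?_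
    have := word_mul_star_word hs [f] [f] n
    rw [word_singleton] at this
    rw [this]
    exact Commute.sum_right _ _ _ fun l hl => hcomm _ (by simp [mem_listsOfLength.1 hl])
  have hdP' : ∀ x, star d * P E x = P E x * star d := fun x => by
    have := (hdP x).star_star
    rwa [star_P] at this
  -- This element compares d S_e d⋆ with S_e. It is a natural sum of degree 0, commutes with the
  -- range projections of long words, and satisfies b b⋆ = S_e S_e⋆, as `eq_of_diagonal` requires.
  set b := d * S E e * star d * star (S E e) with hb
  have hbmem : b ∈ wordSpan E ℕ 0 := by
    have := mul_mem_wordSpan hs (hmem e) (star_S_mem_wordSpan e)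
    rwa [add_neg_cancel] at this
  have hSe : S E e * P E (E.r e) = S E e := S_mul_P e
  have hbS : b * S E e = d * S E e * star d := by
    rw [hb, mul_assoc, (isCKFamily E).star_mul_self, mul_assoc, hdP', ← mul_assoc, mul_assoc d,
      hSe]
  have hbb : b * star b = S E e * star (S E e) := by
    have e1 : star b = S E e * (d * star (S E e) * star d) := by
      rw [hb]; simp only [star_mul, star_star, mul_assoc]
    rw [e1, ← mul_assoc, hbS]
    have e2 : d * S E e * star d * (d * star (S E e) * star d) =
        d * (S E e * (star d * d) * star (S E e)) * star d := by simp only [mul_assoc]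
    rw [e2, hd1, mul_one, hde.eq, mul_assoc, hd2, mul_one]
  -- Stripping a first letter e leaves a tail of length at least n, hence the `n + 1`. Any other
  -- first letter makes both products vanish.
  have hinner : ∀ l : List W, n + 1 ≤ l.length →
      Commute (S E e * star d * star (S E e)) (word E l * star (word E l)) := by
    intro l hl
    cases l with
    | nil => simp at hl
    | cons f k =>
      by_cases hef : e = f
      · subst hef
        have hk : n ≤ k.length := by simpa using hl
        have hq := hcomm' k hk
        have e1 : word E (e :: k) * star (word E (e :: k)) =
            S E e * (word E k * star (word E k)) * star (S E e) := by
          rw [word_cons, star_mul]; simp only [mul_assoc]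
        rw [e1, Commute, SemiconjBy]
        have e2 : S E e * star d * star (S E e) *
            (S E e * (word E k * star (word E k)) * star (S E e)) =
            S E e * star d * P E (E.r e) * (word E k * star (word E k)) * star (S E e) := by
          rw [← (isCKFamily E).star_mul_self]; simp only [mul_assoc]
        have e3 : S E e * (word E k * star (word E k)) * star (S E e) *
            (S E e * star d * star (S E e)) =
            S E e * (word E k * star (word E k)) * (P E (E.r e) * star d) * star (S E e) := by
          rw [← (isCKFamily E).star_mul_self]; simp only [mul_assoc]
        have hPS : P E (E.r e) * star (S E e) = star (S E e) := by
          have := congrArg star hSe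
          rwa [star_mul, star_P] at this
        rw [e2, e3, ← hdP', mul_assoc (S E e) (star d), hdP', ← mul_assoc (S E e), hSe,
          mul_assoc (S E e) (star d), hq.eq, ← hdP']
        simp only [mul_assoc, hPS]
      · have e1 : star (S E e) * word E (f :: k) = 0 := by
          rw [word_cons, ← mul_assoc, (isCKFamily E).star_mul e f hef, zero_mul]
        have e2 : star (word E (f :: k)) * S E e = 0 := by
          have := congrArg star e1
          rwa [star_mul, star_star, star_zero] at this
        rw [Commute, SemiconjBy]
        have e3 : S E e * star d * star (S E e) * (word E (f :: k) * star (word E (f :: k))) = 0 := by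
          rw [mul_assoc, ← mul_assoc (star (S E e)), e1, zero_mul, mul_zero]
        have e4 : word E (f :: k) * star (word E (f :: k)) * (S E e * star d * star (S E e)) = 0 := by
          rw [mul_assoc, ← mul_assoc (star _), ← mul_assoc (star _), e2, zero_mul, zero_mul,
            mul_zero]
        rw [e3, e4]
  have hbq : ∀ l : List W, n + 1 ≤ l.length → Commute b (word E l * star (word E l)) := by
    intro l hl
    have : b = d * (S E e * star d * star (S E e)) := by rw [hb]; simp only [mul_assoc]
    rw [this]
    exact (hcomm l (by omega)).mul_left (hinner l hl)
  have hSw : ∀ l : List W, l ≠ [] → S E e * star (S E e) * word E l = word E l ∨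
      S E e * star (S E e) * word E l = 0 := by
    intro l hl
    cases l with
    | nil => exact absurd rfl hl
    | cons f k =>
      rw [word_cons]
      by_cases hef : e = f
      · subst hef
        left
        rw [← mul_assoc, mul_assoc (S E e), (isCKFamily E).star_mul_self, hSe]
      · right
        rw [mul_assoc, ← mul_assoc (star (S E e)), (isCKFamily E).star_mul e f hef, zero_mul,
          mul_zero]
  have hbeq : b = S E e * star (S E e) := eq_of_diagonal hs hbmem hbq hbb hSw
  rw [← hbS, hbeq, mul_assoc, (isCKFamily E).star_mul_self, hSe]

/-- The phase part `d = p⋆ w` of `w` commutes with the range projections of all long words. -/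
theorem commute_of_matched (hs : E.NoSinks) (H : Implements w h) {n : ℕ}
    {π : Equiv.Perm {l // l ∈ admissible E n}} (hπ : PreservesRange π)
    (hM : ∀ b, ∃ v c, Matched w (π b : List W) b v c) (l : List W) (hl : n ≤ l.length) :
    Commute (star (permElem π) * w) (word E l * star (word E l)) := by
  obtain ⟨b, k, rfl, hb⟩ : ∃ b k, l = b ++ k ∧ b.length = n :=
    ⟨l.take n, l.drop n, (List.take_append_drop _ _).symm, by simp [hl]⟩
  by_cases hb0 : word E b = 0
  · rw [word_append, hb0, zero_mul, zero_mul]; exact Commute.zero_right _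
  obtain ⟨β, rfl⟩ : ∃ β : {l // l ∈ admissible E n}, b = β :=
    ⟨⟨b, mem_admissible.2 ⟨hb, hb0⟩⟩, rfl⟩
  have hu := permElem_mem_unitary hs hπ
  set d := star (permElem π) * w with hd
  have hd1 : star d * d = 1 := by
    rw [hd, star_mul, star_star, mul_assoc, ← mul_assoc (permElem π), hu.2, one_mul,
      H.star_mul_cancel]
  obtain ⟨v, c, hMb⟩ := hM β
  set a : List W := (π β : List W) with ha
  set x := star (word E a) * w * word E (β : List W) with hx
  have hdw : d * word E (β : List W) = word E (β : List W) * x := by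
    rw [hd, mul_assoc, hMb.mul_word, ← mul_assoc, star_permElem_mul_word hπ]
  have hx1 : ‖x‖ ≤ 1 := (norm_star_word_mul_mul_le a β w).trans H.norm_le
  have hone : ‖(1 : CStar E)‖ ≤ 1 := (IsStarProjection.one (CStar E)).norm_le _
  set q := word E k * star (word E k) with hq
  have hq1 : ‖q‖ ≤ 1 := by
    refine (norm_mul_le _ _).trans (mul_le_one₀ (norm_word_le k) (norm_nonneg _) ?_)
    rw [norm_star]; exact norm_word_le k
  have hconj : ∀ p, c • P E v * p * star (c • P E v) = (c * star c) • (P E v * p * P E v) := by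
    intro p
    rw [star_smul, star_P, smul_mul_assoc, smul_mul_smul_comm]
  have h1 := norm_conj_sub_conj_lt hx1 hone hMb.norm_sub_lt
  rw [mul_one, hMb.mul_star, hconj, mul_one, P_mul_P] at h1
  have h2 := norm_conj_sub_conj_lt hx1 hq1 hMb.norm_sub_lt
  rw [hconj] at h2
  have h3 : ‖1 - c * star c‖ < 3 / 100 := by
    have e : P E v - (c * star c) • P E v = (1 - c * star c) • P E v := by
      rw [sub_smul, one_smul]
    rw [e, norm_smul] at h1
    nlinarith [one_le_norm_P hs v, norm_nonneg (1 - c * star c)]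
  have hPq : ‖P E v * q * P E v‖ ≤ 1 := by
    have := norm_P_le (E := E) v
    refine (norm_mul_le _ _).trans (mul_le_one₀ ?_ (norm_nonneg _) this)
    exact (norm_mul_le _ _).trans (mul_le_one₀ this (norm_nonneg _) hq1)
  -- x q x⋆ is within 3/100 of |c|² P_v q P_v, and |c|² is within 3/100 of 1. Both sides are natural
  -- sums of degree 0, so they coincide.
  have h4 : x * q * star x = P E v * q * P E v := by
    apply eq_of_norm_sub_lt hs
    · have := H.conj_mem hs (a := a) (c := a) (b := (β : List W) ++ k) (d := (β : List W) ++ k)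
        rfl rfl
      convert this using 1
      rw [hx, hq, word_append]
      simp only [star_mul, star_star, mul_assoc]
    · have := mul_mem_wordSpan hs (mul_mem_wordSpan hs (P_mem_wordSpan hs v)
        (word_mem_wordSpan k k (d := 0) (by simp))) (P_mem_wordSpan hs v)
      simpa using this
    · have e : x * q * star x - P E v * q * P E v =
          (x * q * star x - (c * star c) • (P E v * q * P E v)) -
            (1 - c * star c) • (P E v * q * P E v) := by
        rw [sub_smul, one_smul]; abel
      rw [e]
      refine (norm_sub_le _ _).trans_lt ?_
      rw [norm_smul]
      nlinarith [norm_nonneg (1 - c * star c), norm_nonneg (P E v * q * P E v)]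
  have h5 : word E ((β : List W) ++ k) * star (word E ((β : List W) ++ k)) =
      word E (β : List W) * (P E v * q * P E v) * star (word E (β : List W)) := by
    have e1 := word_mul_P hMb.init_right
    have e2 := congrArg star e1
    rw [star_mul, star_P] at e2
    rw [word_append, star_mul, hq]
    calc _ = word E (β : List W) * (word E k * star (word E k)) * star (word E (β : List W)) := by
          simp only [mul_assoc]
      _ = (word E (β : List W) * P E v) * (word E k * star (word E k)) *
          (P E v * star (word E (β : List W))) := by rw [e1, e2]
      _ = _ := by simp only [mul_assoc]
  have h6 : d * (word E ((β : List W) ++ k) * star (word E ((β : List W) ++ k))) * star d =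
      word E ((β : List W) ++ k) * star (word E ((β : List W) ++ k)) := by
    calc _ = (d * word E (β : List W)) * q * star (d * word E (β : List W)) := by
          rw [word_append, hq]; simp only [star_mul, mul_assoc]
      _ = word E (β : List W) * (x * q * star x) * star (word E (β : List W)) := by
          rw [hdw]; simp only [star_mul, mul_assoc]
      _ = _ := by rw [h4, h5]
  have h7 := congrArg (· * d) h6
  rw [mul_assoc (d * _), hd1, mul_one] at h7
  exact h7

/-- Conjugation by d = p⋆w fixes every S_e, hence every P_x = ∑ S_e S_e⋆, hence everything; so w = p
d and p implement the same automorphism. -/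
theorem Implements.exists_permElem (hs : E.NoSinks) (H : Implements w h) {n : ℕ}
    {π : Equiv.Perm {l // l ∈ admissible E n}} (hπ : PreservesRange π)
    (hM : ∀ b, ∃ v c, Matched w (π b : List W) b v c) (x : CStar E) :
    h x = permElem π * x * star (permElem π) := by
  have hu := permElem_mem_unitary hs hπ
  set p := permElem (E := E) π with hp
  set d := star p * w with hd
  have hpd : p * d = w := by rw [hd, ← mul_assoc, hu.2, one_mul]
  have hd1 : star d * d = 1 := by
    rw [hd, star_mul, star_star, mul_assoc, ← mul_assoc p, hu.2, one_mul, H.star_mul_cancel]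
  have hd2 : d * star d = 1 := by
    rw [hd, star_mul, star_star, mul_assoc, ← mul_assoc w, H.mul_star_cancel, one_mul, hu.1]
  have hdx : ∀ x, d * x * star d = star p * h x * p := fun x => by
    rw [H.apply_eq, hd, star_mul, star_star]; simp only [mul_assoc]
  have hpmem : p ∈ wordSpan E ℕ 0 := permElem_mem_wordSpan
  have hcomm : ∀ l : List W, n ≤ l.length → Commute d (word E l * star (word E l)) :=
    commute_of_matched hs H hπ hM
  have hS := conj_S_eq_of_commute hs hd1 hd2 hcomm fun e => by
    rw [hdx]
    have := mul_mem_wordSpan hs (mul_mem_wordSpan hs (star_mem_wordSpan hpmem)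
      (H.integral.1 e)) hpmem
    simpa using this
  let D : unitary (CStar E) := ⟨d, hd1, hd2⟩
  have hid : ((Unitary.conjStarAlgAut ℂ (CStar E) D : CStar E ≃⋆ₐ[ℂ] CStar E) :
      CStar E →⋆ₐ[ℂ] CStar E) = StarAlgHom.id ℂ (CStar E) := by
    have hS' : ∀ e, ((Unitary.conjStarAlgAut ℂ (CStar E) D : CStar E ≃⋆ₐ[ℂ] CStar E) :
      CStar E →⋆ₐ[ℂ] CStar E) (S E e) = S E e := hS
    refine hom_ext (fun x => ?_) hS'
    classical
    rw [P_eq_sum hs, map_sum, map_sum]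
    refine Finset.sum_congr rfl fun e _ => ?_
    rw [map_mul, map_star, hS']
    rfl
  have hid' : ∀ x, d * x * star d = x := fun x => DFunLike.congr_fun hid x
  rw [H.apply_eq, ← hpd, star_mul]
  conv_rhs => rw [← hid' x]
  simp only [mul_assoc]

/-- An inner automorphism that preserves the sums of words has finite order. -/
theorem isOfFinOrder_of_mem_integralAut (hs : E.NoSinks) (hsource : E.NoSources)
    (hexit : E.EveryLoopHasExit)
    (hcomm : Subalgebra.centralizer ℂ (core E : Set E.CStar) = ⊥)
    {h : CStar E ≃⋆ₐ[ℂ] CStar E} (hh : h ∈ integralAut hs) (hinner : h ∈ innerAut (CStar E)) :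
    IsOfFinOrder h := by
  obtain ⟨u, rfl⟩ := hinner
  set h := Unitary.conjStarAlgAut ℂ (CStar E) u with hdef
  set w : CStar E := (↑u : CStar E) with hw
  have happ : ∀ x, h x = w * x * star w := fun x => rfl
  have H : Implements w h :=
    ⟨Unitary.coe_star_mul_self u, Unitary.coe_mul_star_self u, happ, hh.1⟩
  have H' : Implements (star w) h.symm := by
    refine ⟨by rw [star_star]; exact H.mul_star_cancel, by rw [star_star]; exact H.star_mul_cancel,
      fun x => ?_, hh.2⟩
    rw [star_star, StarAlgEquiv.symm_apply_eq, happ]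
    calc x = (w * star w) * x * (w * star w) := by rw [H.mul_star_cancel, one_mul, mul_one]
      _ = _ := by simp only [mul_assoc]
  -- The unitary w vanishes only in the zero algebra. Otherwise the graph has a vertex, as the
  -- counting of paths requires.
  by_cases hw0 : w = 0
  · have h10 : (1 : CStar E) = 0 := by rw [← H.mul_star_cancel, hw0, zero_mul]
    have : Subsingleton (CStar E) := subsingleton_of_zero_eq_one h10.symm
    have : h = 1 := by ext x; exact Subsingleton.elim _ _
    rw [this]; exact IsOfFinOrder.one
  have : Nonempty V := by
    by_contra hV
    rw [not_nonempty_iff] at hV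
    apply hw0
    rw [← mul_one w, (isCKFamily E).unit, Finset.univ_eq_empty, Finset.sum_empty, mul_zero]
  -- As h commutes with γ_z, conjugation by w and by γ_z(w) agree on the core. So w⋆γ_z(w) commutes
  -- with the core, and the triviality of the relative commutant makes it a scalar.
  have hgauge : ∀ z, ∃ c : ℂ, gauge E z w = c • w := by
    intro z
    have hmem : star w * gauge E z w ∈ Subalgebra.centralizer ℂ (core E : Set E.CStar) := by
      rw [Subalgebra.mem_centralizer_iff]
      intro x hx
      have e1 : h x = gauge E z w * x * star (gauge E z w) := by
        have := hh.1.equiv_map_gauge z x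
        rw [hx z, happ, map_mul, map_mul, hx z, map_star] at this
        exact this
      have e2 : star (gauge E z w) * gauge E z w = 1 := by
        rw [← map_star, ← map_mul, H.star_mul_cancel, map_one]
      calc x * (star w * gauge E z w) = star w * (w * x * star w) * gauge E z w := by
            rw [← one_mul x, ← H.star_mul_cancel]
            simp only [mul_assoc]
            simp only [← mul_assoc (star w) w, H.star_mul_cancel, one_mul]
        _ = star w * (gauge E z w * x * star (gauge E z w)) * gauge E z w := by
            rw [← happ, e1]
        _ = star w * gauge E z w * x * (star (gauge E z w) * gauge E z w) := by
            simp only [mul_assoc]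
        _ = _ := by rw [e2, mul_one]
    rw [hcomm, Algebra.mem_bot] at hmem
    obtain ⟨c, hc⟩ := hmem
    refine ⟨c, ?_⟩
    calc gauge E z w = w * (star w * gauge E z w) := by
          rw [← mul_assoc, H.mul_star_cancel, one_mul]
      _ = c • w := by rw [← hc, ← Algebra.commutes, ← Algebra.smul_def]
  obtain ⟨d, y, hy, hwy⟩ := exists_homogeneous_norm_sub_lt hs hw0 hgauge (ε := 1 / 100)
    (by norm_num)
  obtain ⟨n, π, hM⟩ := H.exists_matching hs hsource hexit H' hy hwy
  have hπ : PreservesRange π := fun b => by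
    obtain ⟨v, c, hb⟩ := hM b
    exact ⟨v, hb.init_left, hb.init_right⟩
  have hp := H.exists_permElem hs hπ hM
  obtain ⟨k, hk, hpk⟩ := exists_permElem_pow_eq_one hs hπ
  let p : unitary (CStar E) := ⟨permElem π, permElem_mem_unitary hs hπ⟩
  have hhp : h = Unitary.conjStarAlgAut ℂ (CStar E) p := by
    ext x; exact hp x
  rw [hhp, isOfFinOrder_iff_pow_eq_one]
  refine ⟨k, hk, ?_⟩
  have hpk' : p ^ k = 1 := Subtype.ext hpk
  rw [← map_pow, hpk', map_one]

end CStar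

end DirectedGraph

/-! ### Passage to the outer automorphism group -/

theorem corollary4p7 {V W : Type*} [Fintype V] [Fintype W] (E : DirectedGraph V W)
    (hsink : E.NoSinks) (hsource : E.NoSources) (hexit : E.EveryLoopHasExit)
    (hcomm : Subalgebra.centralizer ℂ (DirectedGraph.CStar.core E : Set E.CStar) = ⊥)
    (g : E.CStar ≃⋆ₐ[ℂ] E.CStar) (hg : g ∈ DirectedGraph.CStar.groupGR E)
    (hinf : ¬ IsOfFinOrder g) :
    ¬ IsOfFinOrder (QuotientGroup.mk g : OuterAut E.CStar) := by
  intro hfin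
  obtain ⟨n, hn, hgn⟩ := isOfFinOrder_iff_pow_eq_one.1 hfin
  rw [← QuotientGroup.mk_pow, QuotientGroup.eq_one_iff] at hgn
  have hmem := DirectedGraph.CStar.groupGR_le hsink (pow_mem hg n)
  exact hinf ((DirectedGraph.CStar.isOfFinOrder_of_mem_integralAut hsink hsource hexit hcomm hmem
    hgn).of_pow hn.ne')
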